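/- **Conventions.** All $C^*$-algebras below are unital and $\otimes$ is the minimal tensor product. For $N\in\mathbb N$ consider pairs $(D,M)$ of a $C^*$-algebra $D$ and a matrix $M=(m_{ij})\in M_N(D)$ whose entries generate $D$. An arrow $(D_1,M_1)\to(D_2,M_2)$ is a $^*$-homomorphism $D_1\to D_2$ that maps each entry of $M_1$ to the corresponding entry of $M_2$. A magic unitary is a matrix whose entries are projections that sum up to $1$ in every row and every column. For $M\in M_N(A)$ and $M'\in M_N(B)$ let $M\perp M'\in M_N(A\otimes B)$ be the matrix with entries $\sum_{k}m_{ik}\otimes m'_{kj}$. A pair $(D,u)$ as above is a *compact matrix quantum group* if $u$ is unitary, $(u_{ij}^*)_{ij}$ is invertible, and there is a unital $^*$-homomorphism $\Delta:D\to D\otimes D$ with $\Delta(u_{ij})=\sum_k u_{ik}\otimes u_{kj}$. Let $C(S_N^+)$ be the universal $C^*$-algebra generated by the entries of an $N\times N$ magic unitary $u_{S_N^+}$, and let $C(S_N)$ be the algebra of functions on the symmetric group $S_N$ with the matrix $u_{S_N}$ of functions $u_{ij}(\sigma)=\delta_{i,\sigma(j)}$. **Construction.** Let $N\ge 4$ and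 let $A$ be the universal unital $C^*$-algebra generated by two projections $p,q$. For pairwise different $a,b,c,d\in\{1,\dots,N\}$ let $R_{(a,b),(c,d)}\in M_N(A)$ be the matrix with entries $p$ at $(a,a),(b,b)$; $q$ at $(c,c),(d,d)$; $1$ at all other diagonal positions; $1-p$ at $(a,b),(b,a)$; $1-q$ at $(c,d),(d,c)$; and $0$ elsewhere. For every $a<b$ choose $c,d$ such that $a,b,c,d$ are pairwise different, and put $R_{(a,b),*}=R_{(a,b),(c,d)}$. Let $L$ be such that every permutation in $S_N$ is a product of at most $L$ transpositions. Let $$M_1=\Big(\mathop{\perp}_{1\le a<b\le N}R_{(a,b),*}\Big)^{\perp L}$$ (the factors being taken in any fixed order), let $B_1$ be the $C^*$-algebra generated by the entries of $M_1$, let $M_n=M_1^{\perp n}$ for $n\ge1$, and let $B_n\subseteq B_1^{\otimes n}$ be the $C^*$-algebra generated by the entries of $M_n$. Let $(B_\infty,M_\infty)$ be the inverse limit of $(B_1,M_1)\leftarrow(B_2,M_2)\leftarrow\cdots$, that is, the Hausdorff completion of the free $^*$-algebra on $N^2$ symbols with respect to the seminorm $P\mapsto\sup_{n\ge1}\|P(M_n)\|$,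 together with the matrix of the $N^2$ generators. **Statement.** For every $N\ge4$ and all choices of $L$, of the order of the factors and of the indices $c,d$, the pair $G=(B_\infty,M_\infty)$ is a compact matrix quantum group with $S_N\subsetneq G\subseteq S_N^+$: there are arrows $$(C(S_N^+),u_{S_N^+})\longrightarrow(B_\infty,M_\infty)\longrightarrow(C(S_N),u_{S_N}),$$ and the second one is not injective. -/

import Mathlib

open scoped TensorProduct

noncomputable section

namespace QPerm

/-! ### C*-seminorms on *-algebras and the associated Hausdorff completions -/

/-- A C*-seminorm on a unital complex *-algebra. -/
structure CStarSeminorm (R : Type*) [Ring R] [StarRing R] [Algebra ℂ R] where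
  toFun : R → ℝ
  add_le : ∀ x y, toFun (x + y) ≤ toFun x + toFun y
  smul : ∀ (c : ℂ) x, toFun (c • x) = ‖c‖ * toFun x
  mul_le : ∀ x y, toFun (x * y) ≤ toFun x * toFun y
  star_mul_self : ∀ x, toFun (star x * x) = toFun x * toFun x

namespace CStarSeminorm

variable {R : Type*} [Ring R] [StarRing R] [Algebra ℂ R]

theorem zero' (p : CStarSeminorm R) : p.toFun 0 = 0 := by
  simpa using p.smul 0 0

theorem neg' (p : CStarSeminorm R) (x : R) : p.toFun (-x) = p.toFun x := by
  simpa using p.smul (-1) x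

theorem nonneg (p : CStarSeminorm R) (x : R) : 0 ≤ p.toFun x := by
  have h := p.add_le x (-x)
  rw [add_neg_cancel, p.zero', p.neg'] at h
  linarith

theorem le_star (p : CStarSeminorm R) (x : R) : p.toFun x ≤ p.toFun (star x) := by
  have h := p.mul_le (star x) x
  rw [p.star_mul_self] at h
  rcases (p.nonneg x).eq_or_lt with h0 | h0
  · rw [← h0]; exact p.nonneg _
  · exact le_of_mul_le_mul_right h h0

theorem star_eq (p : CStarSeminorm R) (x : R) : p.toFun (star x) = p.toFun x :=
  le_antisymm (by simpa using p.le_star (star x)) (p.le_star x)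

/-- The pointwise supremum of a pointwise bounded family of C*-seminorms. -/
def iSup {ι : Sort*} (p : ι → CStarSeminorm R)
    (hp : ∀ x, BddAbove (Set.range fun i => (p i).toFun x)) : CStarSeminorm R where
  toFun x := ⨆ i, (p i).toFun x
  add_le x y := Real.iSup_le
    (fun i => ((p i).add_le x y).trans (add_le_add (le_ciSup (hp x) i) (le_ciSup (hp y) i)))
    (add_nonneg (Real.iSup_nonneg fun i => (p i).nonneg x)
      (Real.iSup_nonneg fun i => (p i).nonneg y))
  smul c x := by
    simp only [(p _).smul]
    rw [Real.mul_iSup_of_nonneg (norm_nonneg c)]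
  mul_le x y := Real.iSup_le
    (fun i => ((p i).mul_le x y).trans (mul_le_mul (le_ciSup (hp x) i) (le_ciSup (hp y) i)
      ((p i).nonneg y) (Real.iSup_nonneg fun i => (p i).nonneg x)))
    (mul_nonneg (Real.iSup_nonneg fun i => (p i).nonneg x)
      (Real.iSup_nonneg fun i => (p i).nonneg y))
  star_mul_self x := by
    have hx : 0 ≤ ⨆ i, (p i).toFun x := Real.iSup_nonneg fun i => (p i).nonneg x
    have hs : 0 ≤ ⨆ i, (p i).toFun (star x * x) := Real.iSup_nonneg fun i => (p i).nonneg _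
    apply le_antisymm
    · refine Real.iSup_le (fun i => ?_) (mul_nonneg hx hx)
      rw [(p i).star_mul_self]
      exact mul_self_le_mul_self ((p i).nonneg x) (le_ciSup (hp x) i)
    · rw [← sq, ← Real.le_sqrt hx hs]
      refine Real.iSup_le (fun i => ?_) (Real.sqrt_nonneg _)
      rw [Real.le_sqrt ((p i).nonneg x) hs, sq, ← (p i).star_mul_self]
      exact le_ciSup (hp (star x * x)) i

/-- The C*-seminorm `x ↦ ‖φ x‖` given by a *-homomorphism `φ` into a C*-algebra. -/
def ofHom {D : Type*} [CStarAlgebra D] (φ : R →⋆ₐ[ℂ] D) : CStarSeminorm R where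
  toFun x := ‖φ x‖
  add_le x y := by rw [map_add]; exact norm_add_le _ _
  smul c x := by rw [map_smul, norm_smul]
  mul_le x y := by rw [map_mul]; exact norm_mul_le _ _
  star_mul_self x := by rw [map_mul, map_star, CStarRing.norm_star_mul_self]

/-- The *-algebra `R`, viewed as a seminormed space via the C*-seminorm `p`. -/
def Pre (_ : CStarSeminorm R) : Type _ := R

instance (p : CStarSeminorm R) : Ring p.Pre := inferInstanceAs (Ring R)
instance (p : CStarSeminorm R) : StarRing p.Pre := inferInstanceAs (StarRing R)
instance (p : CStarSeminorm R) : Algebra ℂ p.Pre := inferInstanceAs (Algebra ℂ R)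
instance (p : CStarSeminorm R) [StarModule ℂ R] : StarModule ℂ p.Pre :=
  inferInstanceAs (StarModule ℂ R)

/-- The identity map from `R` to `p.Pre`. -/
def toPre (p : CStarSeminorm R) : R →⋆ₐ[ℂ] p.Pre := StarAlgHom.id ℂ R

instance (p : CStarSeminorm R) : Norm p.Pre := ⟨p.toFun⟩

instance (p : CStarSeminorm R) : SeminormedAddCommGroup p.Pre :=
  SeminormedAddCommGroup.ofCore (𝕜 := ℂ)
    { norm_nonneg := p.nonneg
      norm_smul := p.smul
      norm_triangle := p.add_le }

instance (p : CStarSeminorm R) : SeminormedRing p.Pre :=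
  { (inferInstance : Ring p.Pre), (inferInstance : SeminormedAddCommGroup p.Pre) with
    norm_mul_le := p.mul_le }

instance (p : CStarSeminorm R) : NormedAlgebra ℂ p.Pre where
  norm_smul_le c x := (p.smul c x).le

instance (p : CStarSeminorm R) : NormedStarGroup p.Pre where
  norm_star_le x := (p.star_eq x).le

/-- The C*-algebra obtained from `R` by dividing out the null space of the C*-seminorm `p` and
completing. -/
abbrev Compl (p : CStarSeminorm R) : Type _ := UniformSpace.Completion p.Pre

/-- The canonical map from `R` to its completion, as a function. -/
def coe (p : CStarSeminorm R) (x : R) : p.Compl := ((p.toPre x : p.Pre) : p.Compl)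

theorem norm_coe (p : CStarSeminorm R) (x : R) : ‖p.coe x‖ = p.toFun x :=
  UniformSpace.Completion.norm_coe (p.toPre x)

theorem coe_add (p : CStarSeminorm R) (x y : R) : p.coe (x + y) = p.coe x + p.coe y :=
  UniformSpace.Completion.coe_add (p.toPre x) (p.toPre y)

theorem coe_mul (p : CStarSeminorm R) (x y : R) : p.coe (x * y) = p.coe x * p.coe y :=
  UniformSpace.Completion.coe_mul (p.toPre x) (p.toPre y)

theorem coe_smul (p : CStarSeminorm R) (c : ℂ) (x : R) : p.coe (c • x) = c • p.coe x :=
  UniformSpace.Completion.coe_smul c (p.toPre x)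

theorem denseRange_coe (p : CStarSeminorm R) : DenseRange p.coe :=
  UniformSpace.Completion.denseRange_coe (α := p.Pre)

instance (p : CStarSeminorm R) : NormedAlgebra ℂ p.Compl where
  norm_smul_le := norm_smul_le

@[elab_as_elim]
theorem ind {p : CStarSeminorm R} {P : p.Compl → Prop} (a : p.Compl)
    (hP : IsClosed {a | P a}) (h : ∀ x, P (p.coe x)) : P a :=
  UniformSpace.Completion.induction_on a hP h

@[elab_as_elim]
theorem ind₂ {p : CStarSeminorm R} {P : p.Compl → p.Compl → Prop} (a b : p.Compl)
    (hP : IsClosed {a : p.Compl × p.Compl | P a.1 a.2}) (h : ∀ x y, P (p.coe x) (p.coe y)) :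
    P a b :=
  UniformSpace.Completion.induction_on₂ a b hP h

/-- The involution of the completion: the continuous extension of the involution of `R`. -/
instance (p : CStarSeminorm R) : Star p.Compl where
  star := UniformSpace.Completion.map (star : p.Pre → p.Pre)

theorem continuous_star (p : CStarSeminorm R) : Continuous (star : p.Compl → p.Compl) :=
  UniformSpace.Completion.continuous_map (f := (star : p.Pre → p.Pre))

theorem star_coe (p : CStarSeminorm R) (x : R) : star (p.coe x) = p.coe (star x) :=
  UniformSpace.Completion.map_coe (f := (star : p.Pre → p.Pre))
    (AddMonoidHomClass.isometry_of_norm (starAddEquiv (R := p.Pre))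
      (fun x => norm_star x)).uniformContinuous (p.toPre x)

instance (p : CStarSeminorm R) : StarRing p.Compl where
  star_involutive a := by
    have := p.continuous_star
    induction a using ind with
    | hP => exact isClosed_eq (by fun_prop) (by fun_prop)
    | h x => rw [star_coe, star_coe, star_star]
  star_mul a b := by
    have := p.continuous_star
    induction a, b using ind₂ with
    | hP => exact isClosed_eq (by fun_prop) (by fun_prop)
    | h x y => rw [← coe_mul, star_coe, star_coe, star_coe, star_mul, coe_mul]
  star_add a b := by
    have := p.continuous_star
    induction a, b using ind₂ with
    | hP => exact isClosed_eq (by fun_prop) (by fun_prop)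
    | h x y => rw [← coe_add, star_coe, star_coe, star_coe, star_add, coe_add]

theorem star_smul_compl [StarModule ℂ R] (p : CStarSeminorm R) (c : ℂ) (a : p.Compl) :
    star (c • a) = star c • star a := by
  induction a using ind with
  | hP =>
    exact isClosed_eq (p.continuous_star.comp (continuous_const_smul c))
      ((continuous_const_smul (star c)).comp p.continuous_star)
  | h x => rw [star_coe, ← coe_smul, star_coe, star_smul, coe_smul]

theorem norm_mul_self_le_compl (p : CStarSeminorm R) (a : p.Compl) :
    ‖a‖ * ‖a‖ ≤ ‖star a * a‖ := by
  have := p.continuous_star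
  induction a using ind with
  | hP => exact isClosed_le (by fun_prop) (by fun_prop)
  | h x => rw [star_coe, ← coe_mul, norm_coe, norm_coe, p.star_mul_self]

instance [StarModule ℂ R] (p : CStarSeminorm R) : CStarAlgebra p.Compl where
  norm_mul_self_le := p.norm_mul_self_le_compl
  star_smul := p.star_smul_compl

/-- The canonical *-homomorphism from `R` to its completion. -/
def toCompl [StarModule ℂ R] (p : CStarSeminorm R) : R →⋆ₐ[ℂ] p.Compl where
  toFun := p.coe
  map_one' := rfl
  map_mul' := p.coe_mul
  map_zero' := rfl
  map_add' := p.coe_add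
  commutes' _ := rfl
  map_star' x := (p.star_coe x).symm

theorem toCompl_eq_of [StarModule ℂ R] (p : CStarSeminorm R) {x y : R}
    (h : p.toFun (x - y) = 0) : p.toCompl x = p.toCompl y := by
  rw [← sub_eq_zero, ← map_sub, ← norm_eq_zero]
  exact (p.norm_coe _).trans h

end CStarSeminorm

/-! ### Free *-algebras and *-polynomials -/

/-- The free unital complex *-algebra on a set `X` of generators: the algebra of the free monoid on
`X ⊕ X`, where `Sum.inl x` is the generator `x` and `Sum.inr x` is its adjoint. -/
def FreeStar (X : Type) : Type := MonoidAlgebra ℂ (FreeMonoid (X ⊕ X))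

namespace FreeStar

variable {X : Type}

instance : Ring (FreeStar X) := inferInstanceAs (Ring (MonoidAlgebra ℂ (FreeMonoid (X ⊕ X))))
instance : Algebra ℂ (FreeStar X) :=
  inferInstanceAs (Algebra ℂ (MonoidAlgebra ℂ (FreeMonoid (X ⊕ X))))

/-- The monomial `c • w`. -/
def mono (w : FreeMonoid (X ⊕ X)) (c : ℂ) : FreeStar X := MonoidAlgebra.single w c

/-- The adjoint of a word: reverse the word and exchange each letter with its adjoint. -/
def adj (w : FreeMonoid (X ⊕ X)) : FreeMonoid (X ⊕ X) := FreeMonoid.map Sum.swap (star w)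

theorem adj_mul (v w : FreeMonoid (X ⊕ X)) : adj (v * w) = adj w * adj v := by
  simp [adj]

theorem adj_adj (w : FreeMonoid (X ⊕ X)) : adj (adj w) = w := by
  induction w using FreeMonoid.inductionOn' with
  | one => simp [adj]
  | of_mul x w ih =>
    rw [adj_mul, adj_mul, ih]
    simp [adj]

/-- The involution, as an additive map: `c • w ↦ conj c • adj w`. -/
def starHom : FreeStar X →+ FreeStar X :=
  MonoidAlgebra.liftNC (k := ℂ) (G := FreeMonoid (X ⊕ X)) (R := FreeStar X)
    ((algebraMap ℂ (FreeStar X)).comp (starRingEnd ℂ)).toAddMonoidHom (fun w => mono (adj w) 1)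

theorem mono_mul (v w : FreeMonoid (X ⊕ X)) (b c : ℂ) :
    mono v b * mono w c = mono (v * w) (b * c) := MonoidAlgebra.single_mul_single ..

theorem smul_mono (w : FreeMonoid (X ⊕ X)) (b c : ℂ) : b • mono w c = mono w (b * c) :=
  MonoidAlgebra.smul_single ..

theorem starHom_mono (w : FreeMonoid (X ⊕ X)) (c : ℂ) :
    starHom (mono w c) = mono (adj w) (star c) := by
  refine (MonoidAlgebra.liftNC_single ..).trans ?_
  change algebraMap ℂ (FreeStar X) (star c) * mono (adj w) 1 = _
  rw [← Algebra.smul_def, smul_mono, mul_one]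

@[elab_as_elim]
theorem ind {P : FreeStar X → Prop} (a : FreeStar X) (hm : ∀ w c, P (mono w c))
    (hadd : ∀ a b, P a → P b → P (a + b)) : P a :=
  MonoidAlgebra.induction_linear (motive := P) a
    (by simpa [mono] using! hm 1 0) hadd hm

instance : StarRing (FreeStar X) where
  star := starHom
  star_involutive a := by
    induction a using ind with
    | hm w c => rw [starHom_mono, starHom_mono, adj_adj, star_star]
    | hadd a b ha hb => rw [map_add, map_add, ha, hb]
  star_mul a b := by
    change starHom (a * b) = starHom b * starHom a
    induction a using ind with
    | hadd a a' ha hb => rw [add_mul, map_add, map_add, ha, hb, mul_add]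
    | hm w c =>
      induction b using ind with
      | hadd b b' ha hb => rw [mul_add, map_add, map_add, ha, hb, add_mul]
      | hm v d =>
        rw [mono_mul, starHom_mono, starHom_mono, starHom_mono, mono_mul, adj_mul, star_mul]
  star_add := map_add starHom

theorem star_mono (w : FreeMonoid (X ⊕ X)) (c : ℂ) : star (mono w c) = mono (adj w) (star c) :=
  starHom_mono w c

instance : StarModule ℂ (FreeStar X) where
  star_smul c a := by
    induction a using ind with
    | hm w d => rw [smul_mono, star_mono, star_mono, smul_mono, star_mul, mul_comm]
    | hadd a b ha hb => rw [smul_add, star_add, star_add, ha, hb, smul_add]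

/-- The generator `x`. -/
def gen (x : X) : FreeStar X := mono (FreeMonoid.of (Sum.inl x)) 1

variable {D : Type*} [Ring D] [StarRing D]

/-- The value of a word at a family `f` of elements of `D`. -/
def evalWord (f : X → D) : FreeMonoid (X ⊕ X) →* D :=
  FreeMonoid.lift (Sum.elim f fun x => star (f x))

theorem evalWord_adj (f : X → D) (w : FreeMonoid (X ⊕ X)) :
    evalWord f (adj w) = star (evalWord f w) := by
  induction w using FreeMonoid.inductionOn' with
  | one => simp [adj]
  | of_mul x w ih =>
    rw [adj_mul, map_mul, map_mul, star_mul, ih]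
    congr 1
    rcases x with x | x <;> simp [adj, evalWord]

variable [Algebra ℂ D]

/-- The evaluation of *-polynomials at `f`, as a homomorphism of algebras. -/
def evalHom (f : X → D) : FreeStar X →ₐ[ℂ] D :=
  MonoidAlgebra.lift ℂ D (FreeMonoid (X ⊕ X)) (evalWord f)

theorem evalHom_mono (f : X → D) (w : FreeMonoid (X ⊕ X)) (c : ℂ) :
    evalHom f (mono w c) = c • evalWord f w :=
  MonoidAlgebra.lift_single ..

variable [StarModule ℂ D]

/-- The evaluation of *-polynomials at a family `f` of elements: the *-homomorphism that maps
the generator `x` to `f x`. -/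
def eval (f : X → D) : FreeStar X →⋆ₐ[ℂ] D where
  __ := evalHom f
  map_star' a := by
    change evalHom f (star a) = star (evalHom f a)
    induction a using ind with
    | hm w c => rw [star_mono, evalHom_mono, evalHom_mono, evalWord_adj, star_smul]
    | hadd a b ha hb => rw [star_add, map_add, ha, hb, map_add, star_add]

theorem eval_mono (f : X → D) (w : FreeMonoid (X ⊕ X)) (c : ℂ) :
    eval f (mono w c) = c • evalWord f w :=
  evalHom_mono f w c

theorem eval_gen (f : X → D) (x : X) : eval f (gen x) = f x := by
  rw [gen, eval_mono, one_smul, evalWord, FreeMonoid.lift_eval_of, Sum.elim_inl]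

/-- If the generators are uniformly bounded along a family of evaluations, then so is every
*-polynomial. -/
theorem bddAbove_eval {ι : Sort*} {D : ι → Type*} [∀ i, CStarAlgebra (D i)] (f : ∀ i, X → D i)
    (hf : ∀ x, ∃ C, ∀ i, ‖f i x‖ ≤ C) (a : FreeStar X) :
    BddAbove (Set.range fun i => ‖eval (f i) a‖) := by
  suffices h : ∃ C, ∀ i, ‖eval (f i) a‖ ≤ C by
    obtain ⟨C, hC⟩ := h
    exact ⟨C, by rintro _ ⟨i, rfl⟩; exact hC i⟩
  induction a using ind with
  | hadd a b ha hb =>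
    obtain ⟨C, hC⟩ := ha
    obtain ⟨C', hC'⟩ := hb
    refine ⟨C + C', fun i => ?_⟩
    rw [map_add]
    exact (norm_add_le _ _).trans (add_le_add (hC i) (hC' i))
  | hm w c =>
    suffices h : ∃ C, ∀ i, ‖evalWord (f i) w‖ ≤ C by
      obtain ⟨C, hC⟩ := h
      refine ⟨‖c‖ * C, fun i => ?_⟩
      rw [eval_mono, norm_smul]
      exact mul_le_mul_of_nonneg_left (hC i) (norm_nonneg c)
    induction w using FreeMonoid.inductionOn' with
    | one =>
      refine ⟨1, fun i => ?_⟩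
      rw [map_one]
      rcases subsingleton_or_nontrivial (D i) with _ | _
      · simp [Subsingleton.elim (1 : D i) 0]
      · exact CStarRing.norm_one.le
    | of_mul x w ih =>
      obtain ⟨C, hC⟩ := ih
      obtain ⟨B, hB⟩ : ∃ B, ∀ i, ‖evalWord (f i) (FreeMonoid.of x)‖ ≤ B := by
        rcases x with x | x <;> obtain ⟨B, hB⟩ := hf x <;>
          exact ⟨B, fun i => by simpa [evalWord] using hB i⟩
      refine ⟨B * C, fun i => ?_⟩
      rw [map_mul]
      exact (norm_mul_le _ _).trans (mul_le_mul (hB i) (hC i) (norm_nonneg _)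
        ((norm_nonneg _).trans (hB i)))

end FreeStar

/-! ### Universal C*-algebras -/

/-- A realisation of the relations `rel` on generators `X`: a unital C*-algebra together with a
family of elements that satisfies the relations. A C*-algebra generated by a family indexed by a
type in `Type` is isomorphic to one in `Type`, so this universe sees all realisations. -/
structure Realisation (X : Type) (rel : ∀ (D : Type) [CStarAlgebra D], (X → D) → Prop) where
  D : Type
  [cstar : CStarAlgebra D]
  f : X → D
  holds : rel D f

attribute [instance] Realisation.cstar

section Universal

variable {X : Type} (rel : ∀ (D : Type) [CStarAlgebra D], (X → D) → Prop)
  (hrel : ∀ x, ∃ C : ℝ, ∀ r : Realisation X rel, ‖r.f x‖ ≤ C)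

/-- The largest C*-seminorm on the free *-algebra under which the relations hold: the supremum of
`‖P(f)‖` over all realisations `f` of the relations. -/
def univSeminorm : CStarSeminorm (FreeStar X) :=
  CStarSeminorm.iSup (fun r : Realisation X rel => CStarSeminorm.ofHom (FreeStar.eval r.f))
    (FreeStar.bddAbove_eval (fun r : Realisation X rel => r.f) hrel)

/-- The universal unital C*-algebra `C*(X | rel)`, for relations that bound the norms of the
generators. -/
abbrev UnivCStar : Type := (univSeminorm rel hrel).Compl

/-- The generators of `C*(X | rel)`. -/
def univGen (x : X) : UnivCStar rel hrel := (univSeminorm rel hrel).toCompl (FreeStar.gen x)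

theorem univGen_eq_of {a b : FreeStar X}
    (h : ∀ r : Realisation X rel, FreeStar.eval r.f a = FreeStar.eval r.f b) :
    (univSeminorm rel hrel).toCompl a = (univSeminorm rel hrel).toCompl b := by
  refine CStarSeminorm.toCompl_eq_of _ (le_antisymm (Real.iSup_le (fun r => ?_) le_rfl)
    (CStarSeminorm.nonneg _ _))
  change ‖FreeStar.eval r.f (a - b)‖ ≤ 0
  rw [map_sub, h r, sub_self, norm_zero]

theorem univGen_isStarProjection {x : X} (h : ∀ r : Realisation X rel, IsStarProjection (r.f x)) :
    IsStarProjection (univGen rel hrel x) := by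
  constructor
  · change _ * _ = _
    rw [univGen, ← map_mul]
    refine univGen_eq_of rel hrel fun r => ?_
    rw [map_mul, FreeStar.eval_gen]
    exact (h r).isIdempotentElem
  · change star _ = _
    rw [univGen, ← map_star]
    refine univGen_eq_of rel hrel fun r => ?_
    rw [map_star, FreeStar.eval_gen]
    exact (h r).isSelfAdjoint

end Universal

/-! ### The minimal tensor product -/

section Operators

variable {E : Type*} [NormedAddCommGroup E] [InnerProductSpace ℂ E]

theorem opNorm_smul_eq (c : ℂ) (T : E →L[ℂ] E) : ‖c • T‖ = ‖c‖ * ‖T‖ := norm_smul c T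

theorem opNorm_adj_le (T S : E →L[ℂ] E) (h : ∀ v w, inner ℂ (T v) w = inner ℂ v (S w)) :
    ‖S‖ ≤ ‖T‖ := by
  refine S.opNorm_le_bound (norm_nonneg _) fun w => ?_
  have h1 : ‖S w‖ * ‖S w‖ ≤ ‖T‖ * ‖w‖ * ‖S w‖ := by
    rw [← inner_self_eq_norm_mul_norm (𝕜 := ℂ), ← h]
    refine (RCLike.re_le_norm _).trans ((norm_inner_le_norm _ _).trans ?_)
    have := T.le_opNorm (S w)
    have := mul_le_mul_of_nonneg_right this (norm_nonneg w)
    linarith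
  rcases (norm_nonneg (S w)).eq_or_lt with h0 | h0
  · rw [← h0]; positivity
  · exact le_of_mul_le_mul_right h1 h0

/-- The C*-identity for adjointable bounded operators on an inner product space. -/
theorem opNorm_adj_mul_self (T S : E →L[ℂ] E) (h : ∀ v w, inner ℂ (T v) w = inner ℂ v (S w)) :
    ‖S * T‖ = ‖T‖ * ‖T‖ := by
  apply le_antisymm
  · exact (norm_mul_le _ _).trans
      (mul_le_mul_of_nonneg_right (opNorm_adj_le T S h) (norm_nonneg _))
  · have hle : ‖T‖ ≤ Real.sqrt ‖S * T‖ := by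
      refine T.opNorm_le_bound (Real.sqrt_nonneg _) fun v => ?_
      rw [← Real.sqrt_sq (norm_nonneg v), ← Real.sqrt_mul (norm_nonneg _)]
      refine Real.le_sqrt_of_sq_le ?_
      rw [sq, ← inner_self_eq_norm_mul_norm (𝕜 := ℂ), h]
      refine (RCLike.re_le_norm _).trans ((norm_inner_le_norm _ _).trans ?_)
      have := (S * T).le_opNorm v
      have := mul_le_mul_of_nonneg_left this (norm_nonneg v)
      calc ‖v‖ * ‖S (T v)‖ ≤ ‖v‖ * (‖S * T‖ * ‖v‖) := this
        _ = _ := by ring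
    calc ‖T‖ * ‖T‖ ≤ Real.sqrt ‖S * T‖ * Real.sqrt ‖S * T‖ :=
          mul_self_le_mul_self (norm_nonneg _) hle
      _ = _ := Real.mul_self_sqrt (norm_nonneg _)

end Operators

/-- A pair of unital *-representations of `A` and of `B` on Hilbert spaces. The universe `Type` of
`A` and `B` is large enough for the Hilbert spaces, since it contains those of the cyclic
representations given by the states of `A` and `B`. -/
structure RepPair (A B : Type) [CStarAlgebra A] [CStarAlgebra B] where
  H : Type
  K : Type
  [normH : NormedAddCommGroup H]
  [innerH : InnerProductSpace ℂ H]
  [completeH : CompleteSpace H]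
  [normK : NormedAddCommGroup K]
  [innerK : InnerProductSpace ℂ K]
  [completeK : CompleteSpace K]
  ξ : A →⋆ₐ[ℂ] (H →L[ℂ] H)
  η : B →⋆ₐ[ℂ] (K →L[ℂ] K)

attribute [instance] RepPair.normH RepPair.innerH RepPair.completeH RepPair.normK RepPair.innerK
  RepPair.completeK

namespace RepPair

variable {A B : Type} [CStarAlgebra A] [CStarAlgebra B]

/-- The product representation `ξ ⊗ η` of the algebraic tensor product `A ⊙ B` by bounded operators
on the algebraic tensor product `H ⊙ K` with the inner product
`⟪h ⊗ k, h' ⊗ k'⟫ = ⟪h, h'⟫ ⟪k, k'⟫`. The Hilbert space `H ⊗ K` is the completion of `H ⊙ K`, so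
the operator norm on `H ⊙ K` is the operator norm of the extension to `H ⊗ K`. -/
def rep (r : RepPair A B) : A ⊗[ℂ] B →ₐ[ℂ] (r.H ⊗[ℂ] r.K →L[ℂ] r.H ⊗[ℂ] r.K) :=
  Algebra.TensorProduct.lift
    { toFun := fun a => (r.ξ a).rTensor r.K
      map_one' := by simp
      map_mul' := fun a b => by rw [map_mul, ContinuousLinearMap.rTensor_mul]
      map_zero' := by simp
      map_add' := fun a b => by rw [map_add, ContinuousLinearMap.rTensor_add]
      commutes' := fun c => by simp [Algebra.algebraMap_eq_smul_one] }
    { toFun := fun b => (r.η b).lTensor r.H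
      map_one' := by simp
      map_mul' := fun a b => by rw [map_mul, ContinuousLinearMap.lTensor_mul]
      map_zero' := by simp
      map_add' := fun a b => by rw [map_add, ContinuousLinearMap.lTensor_add]
      commutes' := fun c => by simp [Algebra.algebraMap_eq_smul_one] }
    (fun a b => by
      refine ContinuousLinearMap.ext fun v => ?_
      change (r.ξ a).rTensor r.K ((r.η b).lTensor r.H v) =
        (r.η b).lTensor r.H ((r.ξ a).rTensor r.K v)
      induction v using TensorProduct.induction_on with
      | zero => simp only [map_zero]
      | tmul h k => rfl
      | add v w hv hw => simp only [map_add, hv, hw])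

theorem rep_tmul (r : RepPair A B) (a : A) (b : B) :
    r.rep (a ⊗ₜ b) = TensorProduct.mapL (r.ξ a) (r.η b) :=
  Algebra.TensorProduct.lift_tmul ..

theorem inner_rep (r : RepPair A B) (x : A ⊗[ℂ] B) (v w : r.H ⊗[ℂ] r.K) :
    inner ℂ (r.rep x v) w = inner ℂ v (r.rep (star x) w) := by
  induction x using TensorProduct.induction_on with
  | zero => simp
  | add x y hx hy =>
    simp only [map_add, star_add, add_apply, inner_add_left, inner_add_right,
      hx, hy]
  | tmul a b =>
    rw [TensorProduct.star_tmul, rep_tmul, rep_tmul]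
    induction v using TensorProduct.induction_on with
    | zero => simp
    | add v v' hv hv' => simp only [map_add, inner_add_left, hv, hv']
    | tmul h k =>
      induction w using TensorProduct.induction_on with
      | zero => simp
      | add w w' hw hw' => simp only [map_add, inner_add_right, hw, hw']
      | tmul h' k' =>
        rw [TensorProduct.mapL_tmul, TensorProduct.mapL_tmul, TensorProduct.inner_tmul,
          TensorProduct.inner_tmul, map_star, map_star, ContinuousLinearMap.star_eq_adjoint,
          ContinuousLinearMap.star_eq_adjoint, ContinuousLinearMap.adjoint_inner_right,
          ContinuousLinearMap.adjoint_inner_right]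

/-- The C*-seminorm `x ↦ ‖(ξ ⊗ η)(x)‖` on the algebraic tensor product. -/
def seminorm (r : RepPair A B) : CStarSeminorm (A ⊗[ℂ] B) where
  toFun x := ‖r.rep x‖
  add_le x y := by rw [map_add]; exact ContinuousLinearMap.opNorm_add_le _ _
  smul c x := by rw [map_smul]; exact opNorm_smul_eq _ _
  mul_le x y := by rw [map_mul]; exact ContinuousLinearMap.opNorm_comp_le _ _
  star_mul_self x := by
    rw [map_mul]
    exact opNorm_adj_mul_self _ _ (r.inner_rep x)

theorem bddAbove (x : A ⊗[ℂ] B) :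
    BddAbove (Set.range fun r : RepPair A B => r.seminorm.toFun x) := by
  suffices h : ∃ C, ∀ r : RepPair A B, r.seminorm.toFun x ≤ C by
    obtain ⟨C, hC⟩ := h
    exact ⟨C, by rintro _ ⟨r, rfl⟩; exact hC r⟩
  induction x using TensorProduct.induction_on with
  | zero => exact ⟨0, fun r => r.seminorm.zero'.le⟩
  | add x y hx hy =>
    obtain ⟨C, hC⟩ := hx
    obtain ⟨C', hC'⟩ := hy
    exact ⟨C + C', fun r => (r.seminorm.add_le x y).trans (add_le_add (hC r) (hC' r))⟩
  | tmul a b =>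
    refine ⟨‖a‖ * ‖b‖, fun r => ?_⟩
    change ‖r.rep (a ⊗ₜ b)‖ ≤ _
    rw [rep_tmul]
    exact (TensorProduct.norm_mapL_le _ _).trans (mul_le_mul
      (NonUnitalStarAlgHom.norm_apply_le r.ξ a) (NonUnitalStarAlgHom.norm_apply_le r.η b)
      (norm_nonneg _) (norm_nonneg _))

end RepPair

/-- The minimal C*-norm on `A ⊙ B`: the supremum of `‖(ξ ⊗ η)(x)‖` over all representations `ξ` of
`A` and `η` of `B`. -/
def minNorm (A B : Type) [CStarAlgebra A] [CStarAlgebra B] : CStarSeminorm (A ⊗[ℂ] B) :=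
  CStarSeminorm.iSup (fun r : RepPair A B => r.seminorm) RepPair.bddAbove

/-- The minimal tensor product of two unital C*-algebras. -/
abbrev MinTensor (A B : Type) [CStarAlgebra A] [CStarAlgebra B] : Type := (minNorm A B).Compl

/-- The elementary tensor `a ⊗ b` in the minimal tensor product. -/
def tmul {A B : Type} [CStarAlgebra A] [CStarAlgebra B] (a : A) (b : B) : MinTensor A B :=
  (minNorm A B).toCompl (a ⊗ₜ b)

section tmul

variable {A B : Type} [CStarAlgebra A] [CStarAlgebra B]

theorem tmul_mul_tmul (a a' : A) (b b' : B) :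
    tmul a b * tmul a' b' = tmul (a * a') (b * b') := by
  rw [tmul, tmul, ← map_mul, Algebra.TensorProduct.tmul_mul_tmul, tmul]

theorem star_tmul (a : A) (b : B) : star (tmul a b) = tmul (star a) (star b) := by
  rw [tmul, ← map_star, TensorProduct.star_tmul, tmul]

theorem one_tmul_one : tmul (1 : A) (1 : B) = 1 := by
  rw [tmul, ← Algebra.TensorProduct.one_def, map_one]

theorem zero_tmul (b : B) : tmul (0 : A) b = 0 := by
  rw [tmul, TensorProduct.zero_tmul, map_zero]

theorem sum_tmul {ι : Type*} (t : Finset ι) (f : ι → A) (b : B) :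
    ∑ i ∈ t, tmul (f i) b = tmul (∑ i ∈ t, f i) b := by
  simp only [tmul, ← map_sum, TensorProduct.sum_tmul]

theorem tmul_sum {ι : Type*} (t : Finset ι) (a : A) (f : ι → B) :
    ∑ i ∈ t, tmul a (f i) = tmul a (∑ i ∈ t, f i) := by
  simp only [tmul, ← map_sum, TensorProduct.tmul_sum]

end tmul

/-! ### Matrices over C*-algebras and magic unitaries -/

/-- A matrix over a unital *-algebra is a magic unitary if its entries are projections that sum up
to `1` in every row and in every column. -/
structure IsMagic {N : ℕ} {D : Type*} [Ring D] [StarRing D] (u : Matrix (Fin N) (Fin N) D) :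
    Prop where
  proj : ∀ i j, IsStarProjection (u i j)
  row : ∀ i, ∑ j, u i j = 1
  col : ∀ j, ∑ i, u i j = 1

/-- A pair `(D, M)` of a unital C*-algebra `D` and an `N × N`-matrix `M` over `D`. -/
structure MatPair (N : ℕ) where
  D : Type
  [cstar : CStarAlgebra D]
  M : Matrix (Fin N) (Fin N) D

attribute [instance] MatPair.cstar

namespace MatPair

variable {N : ℕ}

/-- The unital C*-subalgebra of `D` generated by the entries of `M`. For magic unitaries of size
`N ≥ 1` the unit is a sum of entries, so this is also the C*-subalgebra generated by the entries
without the unit adjoined. -/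
def entryAlg (P : MatPair N) : StarSubalgebra ℂ P.D :=
  (StarAlgebra.adjoin ℂ (Set.range fun ij : Fin N × Fin N => P.M ij.1 ij.2)).topologicalClosure

theorem mem_entryAlg (P : MatPair N) (i j : Fin N) : P.M i j ∈ P.entryAlg :=
  StarSubalgebra.le_topologicalClosure _
    (StarAlgebra.subset_adjoin ℂ _ (Set.mem_range_self (i, j)))

instance (P : MatPair N) : IsClosed (P.entryAlg : Set P.D) :=
  StarSubalgebra.isClosed_topologicalClosure _

/-- The pair `(C*(m_ij), M)`: the C*-algebra is cut down to the one generated by the entries. -/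
def cut (P : MatPair N) : MatPair N where
  D := P.entryAlg
  M := Matrix.of fun i j => ⟨P.M i j, P.mem_entryAlg i j⟩

/-- The product of `(A, M)` and `(B, M')`: the matrix with the entries `∑ k, m_ik ⊗ m'_kj` over
the minimal tensor product of `A` and `B`. -/
def oprod (P Q : MatPair N) : MatPair N where
  D := MinTensor P.D Q.D
  M := Matrix.of fun i j => ∑ k, tmul (P.M i k) (Q.M k j)

/-- The product `P₁ ⊥ P₂ ⊥ ⋯ ⊥ Pᵣ` of a list of pairs; by convention, the identity matrix over `ℂ`
for the empty list. -/
def listProd : List (MatPair N) → MatPair N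
  | [] => ⟨ℂ, 1⟩
  | P :: Ps => Ps.foldl oprod P

/-- The `n`-fold product `P ⊥ ⋯ ⊥ P`. -/
def pow (P : MatPair N) (n : ℕ) : MatPair N := listProd (List.replicate n P)

/-- An arrow from `(D₁, M₁)` to `(D₂, M₂)`: a *-homomorphism that maps the entries of `M₁` to the
corresponding entries of `M₂`. -/
structure Arrow (P Q : MatPair N) where
  hom : P.D →⋆ₐ[ℂ] Q.D
  map_entry : ∀ i j, hom (P.M i j) = Q.M i j

/-- `(D, M)` is a compact matrix quantum group: `D` is generated by the entries of `M`, the matrices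
`M = (m_ij)` and `(m_ij^*)` are unitary and invertible, respectively, and there is a
comultiplication `Δ : D → D ⊗ D` with `Δ(m_ij) = ∑ k, m_ik ⊗ m_kj`. -/
structure IsCMQG (P : MatPair N) : Prop where
  generated : P.entryAlg = ⊤
  unitary : P.M ∈ unitary (Matrix (Fin N) (Fin N) P.D)
  invertible : IsUnit (P.M.map star)
  comul : ∃ Δ : P.D →⋆ₐ[ℂ] MinTensor P.D P.D, ∀ i j, Δ (P.M i j) = ∑ k, tmul (P.M i k) (P.M k j)

/-- The inverse limit of an inverse system `P₀ ← P₁ ← P₂ ← ⋯` of pairs whose matrices have bounded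
entries: the Hausdorff completion of the free *-algebra on `N²` symbols `m_ij` with respect to the
C*-seminorm `f ↦ sup_n ‖f(Mₙ)‖`, with the matrix `(m_ij)`. The connecting arrows of an inverse
system are determined by the pairs, since the algebras are generated by the entries of the
matrices; they do not enter the construction. -/
def invLimit (P : ℕ → MatPair N) (hP : ∀ i j, ∃ C : ℝ, ∀ n, ‖(P n).M i j‖ ≤ C) : MatPair N where
  D := (CStarSeminorm.iSup
    (fun n => CStarSeminorm.ofHom
      (FreeStar.eval fun ij : Fin N × Fin N => (P n).M ij.1 ij.2))
    (FreeStar.bddAbove_eval (fun n (ij : Fin N × Fin N) => (P n).M ij.1 ij.2)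
      fun ij => hP ij.1 ij.2)).Compl
  M := Matrix.of fun i j => CStarSeminorm.toCompl _ (FreeStar.gen (i, j))

end MatPair

theorem IsMagic.norm_le_one {N : ℕ} {D : Type*} [CStarAlgebra D] {u : Matrix (Fin N) (Fin N) D}
    (hu : IsMagic u) (i j : Fin N) : ‖u i j‖ ≤ 1 :=
  (hu.proj i j).norm_le

/-- The entries in a row of a magic unitary over a C*-algebra are mutually orthogonal. -/
theorem IsMagic.mul_eq_zero {N : ℕ} {D : Type*} [CStarAlgebra D] {u : Matrix (Fin N) (Fin N) D}
    (hu : IsMagic u) (i : Fin N) {k l : Fin N} (hkl : k ≠ l) : u i k * u i l = 0 := by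
  let _ := CStarAlgebra.spectralOrder D
  have := CStarAlgebra.spectralOrderedRing D
  have hle : u i k ≤ 1 - u i l := by
    have h1 := hu.row i
    rw [← Finset.add_sum_erase _ _ (Finset.mem_univ l),
      ← Finset.add_sum_erase _ _ (Finset.mem_erase.2 ⟨hkl, Finset.mem_univ k⟩)] at h1
    rw [← h1, add_sub_cancel_left]
    exact le_add_of_nonneg_right (Finset.sum_nonneg fun j _ => (hu.proj i j).nonneg)
  have := (IsStarProjection.le_iff_mul_eq_left (hu.proj i k) (hu.proj i l).one_sub).1 hle
  rw [mul_sub, mul_one, sub_eq_self] at this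
  exact this

/-! ### The quantum permutation group and the permutation group -/

/-- `C(S_N^+)`, the universal C*-algebra generated by the entries of an `N × N` magic unitary,
together with its generating matrix. -/
def SNplus (N : ℕ) : MatPair N where
  D := UnivCStar (X := Fin N × Fin N) (fun _ _ u => IsMagic (Matrix.of fun i j => u (i, j)))
    fun ij => ⟨1, fun r => r.holds.norm_le_one ij.1 ij.2⟩
  M := Matrix.of fun i j => univGen _ _ (i, j)

/-- `C(S_N)` with its generating matrix, the functions `u_ij(σ) = δ_{i,σ(j)}` that read off the
entries of a permutation matrix. -/
def SN (N : ℕ) : MatPair N where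
  D := Equiv.Perm (Fin N) → ℂ
  M := Matrix.of fun i j σ => if i = σ j then 1 else 0

/-! ### The pairs `(B₁, M₁)`, `(Bₙ, Mₙ)` and `(B_∞, M_∞)` -/

/-- The universal unital C*-algebra `A` generated by two projections. -/
abbrev TwoProj : Type :=
  UnivCStar (X := Fin 2) (fun _ _ f => ∀ x, IsStarProjection (f x))
    fun x => ⟨1, fun r => (r.holds x).norm_le⟩

/-- The first generating projection of `A`. -/
def projP : TwoProj := univGen _ _ 0

/-- The second generating projection of `A`. -/
def projQ : TwoProj := univGen _ _ 1

/-- The matrix `R_{(a,b),(c,d)}` with entries `p`, `q`, `1 - p`, `1 - q`, `1` and `0`. -/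
def matR {N : ℕ} {D : Type*} [Ring D] (p q : D) (a b c d : Fin N) : Matrix (Fin N) (Fin N) D :=
  Matrix.of fun i j =>
    if i = j then
      if i = a ∨ i = b then p else if i = c ∨ i = d then q else 1
    else if i = a ∧ j = b ∨ i = b ∧ j = a then 1 - p
    else if i = c ∧ j = d ∨ i = d ∧ j = c then 1 - q
    else 0

/-- The pair `(A, R_{(a,b),(c,d)})`. -/
def pairR {N : ℕ} (a b c d : Fin N) : MatPair N := ⟨TwoProj, matR projP projQ a b c d⟩

theorem isStarProjection_projP : IsStarProjection projP :=
  univGen_isStarProjection _ _ fun r => r.holds 0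

theorem isStarProjection_projQ : IsStarProjection projQ :=
  univGen_isStarProjection _ _ fun r => r.holds 1

section matR

variable {N : ℕ} {D : Type*} [Ring D] (p q : D) {a b c d : Fin N}

theorem matR_symm (a b c d i j : Fin N) : matR p q a b c d i j = matR p q a b c d j i := by
  simp only [matR, Matrix.of_apply]
  by_cases h : i = j
  · subst h; rfl
  · rw [if_neg h, if_neg (Ne.symm h)]
    congr 1
    · exact propext ⟨fun h => by tauto, fun h => by tauto⟩
    · congr 1
      exact propext ⟨fun h => by tauto, fun h => by tauto⟩

theorem matR_row (h : [a, b, c, d].Nodup) (i : Fin N) : ∑ j, matR p q a b c d i j = 1 := by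
  suffices H : ∃ (k : Fin N) (e : D), ∀ j, matR p q a b c d i j =
      (if j = i then e else 0) + (if j = k then 1 - e else 0) by
    obtain ⟨k, e, H⟩ := H
    rw [Finset.sum_congr rfl fun j _ => H j, Finset.sum_add_distrib]
    simp
  simp only [List.nodup_cons, List.mem_cons, List.not_mem_nil, or_false, not_or] at h
  obtain ⟨⟨hab, hac, had⟩, ⟨hbc, hbd⟩, hcd, -⟩ := h
  simp only [matR, Matrix.of_apply]
  by_cases hia : i = a
  · exact ⟨b, p, fun j => by grind⟩
  by_cases hib : i = b
  · exact ⟨a, p, fun j => by grind⟩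
  by_cases hic : i = c
  · exact ⟨d, q, fun j => by grind⟩
  by_cases hid : i = d
  · exact ⟨c, q, fun j => by grind⟩
  · exact ⟨i, 1, fun j => by grind⟩

theorem matR_magic [StarRing D] {p q : D} (hp : IsStarProjection p) (hq : IsStarProjection q)
    (h : [a, b, c, d].Nodup) : IsMagic (matR p q a b c d) where
  proj i j := by
    simp only [matR, Matrix.of_apply]
    split_ifs
    exacts [hp, hq, IsStarProjection.one _, hp.one_sub, hq.one_sub, IsStarProjection.zero _]
  row := matR_row p q h
  col j := by
    simp only [matR_symm p q a b c d _ j]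
    exact matR_row p q h j

end matR

namespace MatPair

variable {N : ℕ}

theorem cut_magic {P : MatPair N} (h : IsMagic P.M) : IsMagic P.cut.M where
  proj i j := ⟨Subtype.ext (h.proj i j).isIdempotentElem, Subtype.ext (h.proj i j).isSelfAdjoint⟩
  row i := Subtype.ext ((AddSubmonoidClass.coe_finsetSum _ _).trans (h.row i))
  col j := Subtype.ext ((AddSubmonoidClass.coe_finsetSum _ _).trans (h.col j))

theorem oprod_magic {P Q : MatPair N} (hP : IsMagic P.M) (hQ : IsMagic Q.M) :
    IsMagic (P.oprod Q).M where
  proj i j := by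
    constructor
    · change (∑ k, tmul (P.M i k) (Q.M k j)) * (∑ k, tmul (P.M i k) (Q.M k j)) =
        ∑ k, tmul (P.M i k) (Q.M k j)
      rw [Finset.sum_mul_sum]
      refine Finset.sum_congr rfl fun k _ => ?_
      rw [Finset.sum_eq_single k]
      · rw [tmul_mul_tmul, (hP.proj i k).isIdempotentElem, (hQ.proj k j).isIdempotentElem]
      · intro l _ hl
        rw [tmul_mul_tmul, hP.mul_eq_zero i hl.symm, zero_tmul]
      · simp
    · change star (∑ k, tmul (P.M i k) (Q.M k j)) = ∑ k, tmul (P.M i k) (Q.M k j)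
      rw [star_sum]
      refine Finset.sum_congr rfl fun k _ => ?_
      rw [star_tmul, (hP.proj i k).isSelfAdjoint, (hQ.proj k j).isSelfAdjoint]
  row i := by
    change ∑ j, ∑ k, tmul (P.M i k) (Q.M k j) = 1
    rw [Finset.sum_comm]
    simp only [tmul_sum, hQ.row, sum_tmul, hP.row, one_tmul_one]
  col j := by
    change ∑ i, ∑ k, tmul (P.M i k) (Q.M k j) = 1
    rw [Finset.sum_comm]
    simp only [sum_tmul, hP.col, tmul_sum, hQ.col, one_tmul_one]

theorem foldl_magic (l : List (MatPair N)) (P : MatPair N) (hP : IsMagic P.M)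
    (h : ∀ Q ∈ l, IsMagic Q.M) : IsMagic (l.foldl oprod P).M := by
  induction l generalizing P with
  | nil => exact hP
  | cons Q l ih =>
    exact ih _ (oprod_magic hP (h Q List.mem_cons_self)) fun Q' hQ' =>
      h Q' (List.mem_cons_of_mem _ hQ')

theorem listProd_magic {l : List (MatPair N)} (h : ∀ P ∈ l, IsMagic P.M) :
    IsMagic (listProd l).M := by
  cases l with
  | nil =>
    refine ⟨fun i j => ?_, fun i => ?_, fun j => ?_⟩
    · change IsStarProjection ((1 : Matrix (Fin N) (Fin N) ℂ) i j)
      rw [Matrix.one_apply]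
      split_ifs
      exacts [IsStarProjection.one _, IsStarProjection.zero _]
    · change ∑ j, (1 : Matrix (Fin N) (Fin N) ℂ) i j = 1
      simp [Matrix.one_apply]
    · change ∑ i, (1 : Matrix (Fin N) (Fin N) ℂ) i j = 1
      simp [Matrix.one_apply]
  | cons P l =>
    exact foldl_magic l P (h P List.mem_cons_self) fun Q hQ => h Q (List.mem_cons_of_mem _ hQ)

theorem pow_magic {P : MatPair N} (h : IsMagic P.M) (n : ℕ) : IsMagic (P.pow n).M :=
  listProd_magic fun Q hQ => by rwa [List.eq_of_mem_replicate hQ]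

end MatPair

/-- The choices in the construction of `M₁`. -/
structure StartData (N : ℕ) where
  /-- A number `L` such that every permutation is a product of at most `L` transpositions. -/
  L : ℕ
  prod_of_swaps : ∀ σ : Equiv.Perm (Fin N), ∃ l : List (Equiv.Perm (Fin N)),
    l.length ≤ L ∧ (∀ τ ∈ l, τ.IsSwap) ∧ l.prod = σ
  /-- The order of the factors: an enumeration of the pairs `(a, b)` with `a < b`. -/
  pairs : List (Fin N × Fin N)
  nodup_pairs : pairs.Nodup
  mem_pairs : ∀ ab, ab ∈ pairs ↔ ab.1 < ab.2
  /-- The indices `c` and `d` that are chosen for each pair `(a, b)`. -/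
  c : Fin N × Fin N → Fin N
  d : Fin N × Fin N → Fin N
  distinct : ∀ a b, a < b → [a, b, c (a, b), d (a, b)].Nodup

namespace StartData

open MatPair

variable {N : ℕ} (s : StartData N)

/-- The matrix `R_{(a,b),*}`. -/
def R (ab : Fin N × Fin N) : MatPair N := pairR ab.1 ab.2 (s.c ab) (s.d ab)

/-- The pair `(B₁, M₁)`: the matrix `M₁` is the `L`-th power of the product of all `R_{(a,b),*}`
with `a < b`, and `B₁` is the C*-algebra generated by its entries. -/
def B₁ : MatPair N := ((listProd (s.pairs.map s.R)).pow s.L).cut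

/-- The pair `(Bₙ, Mₙ)` for `n ≥ 1`: the matrix `Mₙ` is the `n`-th power of `M₁`, and `Bₙ` is the
C*-algebra generated by its entries. -/
def B (n : ℕ) : MatPair N := (s.B₁.pow n).cut

theorem B₁_magic : IsMagic s.B₁.M :=
  cut_magic (pow_magic (listProd_magic (by
    intro P hP
    obtain ⟨ab, hab, rfl⟩ := List.mem_map.1 hP
    exact matR_magic isStarProjection_projP isStarProjection_projQ (s.distinct ab.1 ab.2 ((s.mem_pairs ab).1 hab)))) _)

theorem B_magic (n : ℕ) : IsMagic (s.B n).M := cut_magic (pow_magic s.B₁_magic n)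

/-- The inverse limit `(B_∞, M_∞)` of `(B₁, M₁) ← (B₂, M₂) ← ⋯`. -/
def Binf : MatPair N :=
  invLimit (fun n => s.B (n + 1)) fun i j => ⟨1, fun n => (s.B_magic (n + 1)).norm_le_one i j⟩

end StartData

end QPerm

end

/-! Pairs are compared through the norms of *-polynomials in the matrix entries: `MatPair.Le P Q`
means `‖f(P)‖ ≤ ‖f(Q)‖` for all `f`. If `Q` is generated by its entries, this amounts to an arrow
from `Q` to `P`. The limit `Binf` is the least upper bound of the pairs `Bₙ`, `n ≥ 1`, so every pair
below `Binf` receives an arrow from it (`exists_arrow_of_le`), and all that remains is to prove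
inequalities.

A comultiplication is an arrow `Binf → Binf ⊥ Binf`, that is, `Binf ⊥ Binf ≤ Binf`. By
`Dominated.oprod` it suffices to bound the products of `Bₙ` and `Bₘ`, and up to bracketing these
carry the matrix `M_{n+m}` (`oprod_assoc_le`, `pow_oprod_pow_le`). The analytic core is
`Rep.minNorm_le`: the minimal norm can be computed from arbitrary separating sets of representations
of the factors. Compressing one leg to finite-dimensional subspaces yields matrices over the other
algebra, and there separating families of C*-seminorms determine the norm. The magic relations are
*-polynomial identities, hence survive in the limit; they give unitarity and the arrow from
`C(S_N^+)`.

For the lower bound, `R_{(a,b),*}` specialises to the identity at `p = q = 1` and to the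
transposition of `a` and `b` at `p = 0`, `q = 1`. Because every factor dominates the identity, a
product dominates each of its factors. Hence `M₁` dominates all permutation matrices, which gives
the arrow to `C(S_N)`, and it dominates every `R_{(a,b),*}`. The latter has the noncommuting entries
`p` and `q`, so `B_∞` is not commutative and the arrow to the commutative algebra `C(S_N)` cannot be
injective. -/

noncomputable section

namespace QPerm

/-! ### Positive functionals and the GNS representation. -/

open scoped ComplexOrder in
/-- A nonzero element of a C*-algebra is seen by some positive functional. -/
theorem exists_positive_functional {A : Type*} [CStarAlgebra A] [PartialOrder A]
    [StarOrderedRing A] {h : A} (h0 : 0 ≤ h) (hne : h ≠ 0) :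
    ∃ f : A →ₚ[ℂ] ℂ, f h ≠ 0 := by
  let C : ProperCone ℝ A :=
    { carrier := {a | 0 ≤ a}
      add_mem' := fun ha hb => add_nonneg ha hb
      zero_mem' := le_rfl
      smul_mem' := fun c a ha => smul_nonneg c.2 ha
      isClosed' := CStarAlgebra.isClosed_nonneg }
  have hC : -h ∉ C := fun hm => hne (le_antisymm (neg_nonneg.1 hm) h0)
  obtain ⟨f, hf, hfh⟩ := C.hyperplane_separation_point hC
  -- Symmetrising under the involution makes the complex-linear extension of `g` real on
  -- self-adjoint elements: there the imaginary part `g (I • a)` cancels.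
  let g : Module.Dual ℝ A :=
    (f : A →ₗ[ℝ] ℝ) + (f : A →ₗ[ℝ] ℝ) ∘ₗ (starLinearEquiv ℝ (A := A)).toLinearMap
  have key : ∀ a : A, IsSelfAdjoint a →
      (Module.Dual.extendRCLike (𝕜 := ℂ) g : A →ₗ[ℂ] ℂ) a = ((2 * f a : ℝ) : ℂ) := by
    intro a ha
    have h1 : g a = 2 * f a := by
      change f a + f (star a) = _
      rw [ha.star_eq]; ring
    have h2 : g (Complex.I • a) = 0 := by
      change f _ + f (star (Complex.I • a)) = _
      rw [star_smul, ha.star_eq, ← map_add]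
      simp
    rw [Module.Dual.extendRCLike_apply, h1]
    simp [h2]
  refine ⟨PositiveLinearMap.mk₀ (Module.Dual.extendRCLike (𝕜 := ℂ) g) fun a ha => ?_, ?_⟩
  · rw [key a (IsSelfAdjoint.of_nonneg ha)]
    have := hf a ha
    exact_mod_cast mul_nonneg zero_le_two this
  · change (Module.Dual.extendRCLike (𝕜 := ℂ) g : A →ₗ[ℂ] ℂ) h ≠ 0
    rw [key h (IsSelfAdjoint.of_nonneg h0)]
    rw [map_neg] at hfh
    have : f h ≠ 0 := by linarith [hfh] |> ne_of_gt
    exact_mod_cast mul_ne_zero two_ne_zero this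

/-- The representations of a C*-algebra on Hilbert spaces separate its points. -/
theorem exists_rep_ne_zero {A : Type} [CStarAlgebra A] {a : A} (ha : a ≠ 0) :
    ∃ (H : Type) (_ : NormedAddCommGroup H) (_ : InnerProductSpace ℂ H) (_ : CompleteSpace H)
      (π : A →⋆ₐ[ℂ] (H →L[ℂ] H)), π a ≠ 0 := by
  let _ := CStarAlgebra.spectralOrder A
  have := CStarAlgebra.spectralOrderedRing A
  obtain ⟨f, hf⟩ := exists_positive_functional (star_mul_self_nonneg a)
    (by simpa using ha)
  refine ⟨f.GNS, inferInstance, inferInstance, inferInstance, f.gnsStarAlgHom, fun h => hf ?_⟩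
  -- The class of `1` is the cyclic vector, and the squared norm of its image under `a` is `f (star
  -- a * a)`.
  have h1 : f.gnsStarAlgHom a ((f.toPreGNS 1 : f.PreGNS) : f.GNS) = 0 := by rw [h]; rfl
  have h2 : ((f.leftMulMapPreGNS a (f.toPreGNS 1) : f.PreGNS) : f.GNS) = 0 := by
    rw [← h1]
    exact (f.gnsNonUnitalStarAlgHom_apply_coe).symm
  have h3 : ‖f.leftMulMapPreGNS a (f.toPreGNS 1)‖ = 0 := by
    rw [← UniformSpace.Completion.norm_coe, h2, norm_zero]
  have h4 := f.preGNS_norm_sq (f.leftMulMapPreGNS a (f.toPreGNS 1))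
  rw [h3] at h4
  simpa using h4.symm

/-! ### Extension to completions and separating families of C*-seminorms. -/

namespace CStarSeminorm

section lift
variable {R : Type*} [Ring R] [StarRing R] [Algebra ℂ R] [StarModule ℂ R]

/-- A *-homomorphism dominated by a C*-seminorm extends to the completion. -/
theorem exists_lift (p : CStarSeminorm R) {D : Type*} [CStarAlgebra D] (φ : R →⋆ₐ[ℂ] D)
    (h : ∀ x, ‖φ x‖ ≤ p.toFun x) : ∃ ψ : p.Compl →⋆ₐ[ℂ] D, ∀ x, ψ (p.toCompl x) = φ x := by
  let φ' : p.Pre →+* D := (φ : R →+* D)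
  have hc : Continuous φ' :=
    AddMonoidHomClass.continuous_of_bound φ' 1 fun x => (h x).trans_eq (one_mul _).symm
  let ψ : p.Compl →+* D := UniformSpace.Completion.extensionHom φ' hc
  have hψ : Continuous ψ := UniformSpace.Completion.continuous_extension
  have hx : ∀ x, ψ (p.coe x) = φ x := fun x => UniformSpace.Completion.extensionHom_coe φ' hc _
  have hs := p.continuous_star
  refine ⟨{ ψ with
    commutes' := fun c => ?_
    map_star' := fun a => ?_ }, hx⟩
  · change ψ (algebraMap ℂ p.Compl c) = _
    rw [Algebra.algebraMap_eq_smul_one, Algebra.algebraMap_eq_smul_one]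
    change ψ (c • p.coe 1) = _
    rw [← coe_smul, hx, map_smul, map_one]
  · change ψ (star a) = star (ψ a)
    induction a using ind with
    | hP => exact isClosed_eq (by fun_prop) (by fun_prop)
    | h x => rw [star_coe, hx, hx, map_star]

end lift

variable {B : Type*} [CStarAlgebra B]

/-- A C*-seminorm on a C*-algebra is dominated by the norm. -/
theorem le_norm (p : CStarSeminorm B) (x : B) : p.toFun x ≤ ‖x‖ := by
  rw [← p.norm_coe]
  exact NonUnitalStarAlgHom.norm_apply_le p.toCompl x

/-- A family of C*-seminorms on a C*-algebra that separates the points determines the norm. -/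
theorem norm_le_of_separating {ι : Sort*} (p : ι → CStarSeminorm B)
    (hp : ∀ x, (∀ i, (p i).toFun x = 0) → x = 0) (x : B) {C : ℝ} (hC : 0 ≤ C)
    (h : ∀ i, (p i).toFun x ≤ C) : ‖x‖ ≤ C := by
  have hb : ∀ x, BddAbove (Set.range fun i => (p i).toFun x) := fun x =>
    ⟨‖x‖, by rintro _ ⟨i, rfl⟩; exact (p i).le_norm x⟩
  let q := CStarSeminorm.iSup p hb
  -- Separation makes the map to the completion for the supremum injective; injective
  -- *-homomorphisms of C*-algebras are isometric.
  have hinj : Function.Injective q.toCompl := by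
    refine (injective_iff_map_eq_zero _).2 fun y hy => hp y fun i => ?_
    have h0 : q.toFun y = 0 := by rw [← q.norm_coe]; exact norm_eq_zero.2 hy
    exact le_antisymm (h0 ▸ le_ciSup (hb y) i) ((p i).nonneg y)
  rw [← NonUnitalStarAlgHom.norm_map q.toCompl hinj x]
  exact (q.norm_coe x).trans_le (Real.iSup_le h hC)

end CStarSeminorm

/-! ### Representations, matrix compressions and the minimal norm. -/

section Operators

variable {E : Type*} [NormedAddCommGroup E] [InnerProductSpace ℂ E]

/-- The inner product of an inner product space. On tensor products this fixes the path to the inner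
product through the structure of an inner product space. -/
def ip (v w : E) : ℂ := inner ℂ v w

theorem ip_add_right (u v w : E) : ip u (v + w) = ip u v + ip u w := inner_add_right ..

theorem ip_self (v : E) : ip v v = (‖v‖ : ℂ) ^ 2 := inner_self_eq_norm_sq_to_K v

theorem norm_ip_le (v w : E) : ‖ip v w‖ ≤ ‖v‖ * ‖w‖ := norm_inner_le_norm v w

/-- Test with `w = T v`. Completeness of `E` is not assumed, so this applies to algebraic tensor
products of Hilbert spaces. -/
theorem opNorm_le_of_inner (T : E →L[ℂ] E) {C : ℝ} (hC : 0 ≤ C)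
    (h : ∀ v w, ‖ip w (T v)‖ ≤ C * ‖w‖ * ‖v‖) : ‖T‖ ≤ C := by
  refine T.opNorm_le_bound hC fun v => ?_
  have h1 := h v (T v)
  rw [ip, inner_self_eq_norm_sq_to_K, norm_pow] at h1
  simp only [RCLike.norm_ofReal, abs_norm] at h1
  rcases (norm_nonneg (T v)).eq_or_lt with h0 | h0
  · rw [← h0]; positivity
  · refine le_of_mul_le_mul_right ?_ h0
    linarith

end Operators

/-- A unital *-representation of a C*-algebra on a Hilbert space. -/
structure Rep (A : Type) [CStarAlgebra A] where
  H : Type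
  [normed : NormedAddCommGroup H]
  [innerProd : InnerProductSpace ℂ H]
  [complete : CompleteSpace H]
  π : A →⋆ₐ[ℂ] (H →L[ℂ] H)

attribute [instance] Rep.normed Rep.innerProd Rep.complete

namespace Rep

variable {A B : Type} [CStarAlgebra A] [CStarAlgebra B]

/-- A set of representations separates the points of the C*-algebra. -/
def Separating (S : Set (Rep A)) : Prop := ∀ a, (∀ ρ ∈ S, ρ.π a = 0) → a = 0

theorem separating_univ : Separating (Set.univ : Set (Rep A)) := by
  intro a h
  by_contra ha
  obtain ⟨H, _, _, _, π, hπ⟩ := exists_rep_ne_zero ha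
  exact hπ (h ⟨H, π⟩ trivial)

/-- The restriction of a representation along a *-homomorphism. -/
def comp (σ : Rep B) (φ : A →⋆ₐ[ℂ] B) : Rep A := ⟨σ.H, σ.π.comp φ⟩

/-- The pair formed by two representations. -/
def pair (ρ : Rep A) (σ : Rep B) : RepPair A B := ⟨ρ.H, σ.H, ρ.π, σ.π⟩

/-- The product representation `ρ ⊗ σ` of the algebraic tensor product. -/
def tensorOp (ρ : Rep A) (σ : Rep B) : A ⊗[ℂ] B →ₐ[ℂ] (ρ.H ⊗[ℂ] σ.H →L[ℂ] ρ.H ⊗[ℂ] σ.H) :=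
  (ρ.pair σ).rep

theorem tensorOp_tmul (ρ : Rep A) (σ : Rep B) (a : A) (b : B) :
    ρ.tensorOp σ (a ⊗ₜ b) = TensorProduct.mapL (ρ.π a) (σ.π b) :=
  RepPair.rep_tmul ..

/-- The norm of `(ρ ⊗ σ)(x)`. -/
def tensorNorm (ρ : Rep A) (σ : Rep B) (x : A ⊗[ℂ] B) : ℝ := (ρ.pair σ).seminorm.toFun x

theorem tensorNorm_nonneg (ρ : Rep A) (σ : Rep B) (x : A ⊗[ℂ] B) : 0 ≤ ρ.tensorNorm σ x :=
  (ρ.pair σ).seminorm.nonneg x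

theorem norm_tensorOp_apply_le (ρ : Rep A) (σ : Rep B) (x : A ⊗[ℂ] B) (v : ρ.H ⊗[ℂ] σ.H) :
    ‖ρ.tensorOp σ x v‖ ≤ ρ.tensorNorm σ x * ‖v‖ :=
  (ρ.tensorOp σ x).le_opNorm v

theorem tensorNorm_le (ρ : Rep A) (σ : Rep B) (x : A ⊗[ℂ] B) {C : ℝ} (hC : 0 ≤ C)
    (h : ∀ v, ‖ρ.tensorOp σ x v‖ ≤ C * ‖v‖) : ρ.tensorNorm σ x ≤ C :=
  ContinuousLinearMap.opNorm_le_bound _ hC h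

theorem tensorNorm_le_of_ip (ρ : Rep A) (σ : Rep B) (x : A ⊗[ℂ] B) {C : ℝ} (hC : 0 ≤ C)
    (h : ∀ v w, ‖ip w (ρ.tensorOp σ x v)‖ ≤ C * ‖w‖ * ‖v‖) : ρ.tensorNorm σ x ≤ C :=
  opNorm_le_of_inner _ hC h

theorem inner_tensorOp (ρ : Rep A) (σ : Rep B) (x : A ⊗[ℂ] B) (v w : ρ.H ⊗[ℂ] σ.H) :
    inner ℂ (ρ.tensorOp σ x v) w = inner ℂ v (ρ.tensorOp σ (star x) w) :=
  (ρ.pair σ).inner_rep x v w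

section matOp

variable {ι : Type} [Fintype ι]

/-- The operator on `K ⊕ ⋯ ⊕ K` given by a matrix over `B` and a representation of `B` on `K`. -/
def matOp (σ : Rep B) (Y : CStarMatrix ι ι B) :
    PiLp 2 (fun _ : ι => σ.H) →L[ℂ] PiLp 2 (fun _ : ι => σ.H) :=
  (PiLp.continuousLinearEquiv 2 ℂ fun _ : ι => σ.H).symm.toContinuousLinearMap ∘L
    ContinuousLinearMap.pi fun i => ∑ j, σ.π (Y i j) ∘L PiLp.proj 2 (fun _ : ι => σ.H) j

theorem matOp_apply (σ : Rep B) (Y : CStarMatrix ι ι B) (v : PiLp 2 fun _ : ι => σ.H) (i : ι) :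
    σ.matOp Y v i = ∑ j, σ.π (Y i j) (v j) := by
  simp [matOp]

theorem matOp_add (σ : Rep B) (Y Z : CStarMatrix ι ι B) :
    σ.matOp (Y + Z) = σ.matOp Y + σ.matOp Z := by
  ext v i
  simp [matOp_apply, Finset.sum_add_distrib]

theorem matOp_smul (σ : Rep B) (c : ℂ) (Y : CStarMatrix ι ι B) :
    σ.matOp (c • Y) = c • σ.matOp Y := by
  ext v i
  simp [matOp_apply, Finset.smul_sum]

theorem matOp_mul (σ : Rep B) (Y Z : CStarMatrix ι ι B) :
    σ.matOp (Y * Z) = σ.matOp Y * σ.matOp Z := by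
  ext v i
  rw [mul_apply_eq_comp]
  simp only [matOp_apply, CStarMatrix.mul_apply, map_sum, map_mul,
    sum_apply, mul_apply_eq_comp]
  rw [Finset.sum_comm]

theorem inner_matOp (σ : Rep B) (Y : CStarMatrix ι ι B) (v w : PiLp 2 fun _ : ι => σ.H) :
    inner ℂ (σ.matOp Y v) w = inner ℂ v (σ.matOp (star Y) w) := by
  simp only [PiLp.inner_apply, matOp_apply, sum_inner, inner_sum, CStarMatrix.star_apply, map_star,
    ContinuousLinearMap.star_eq_adjoint, ContinuousLinearMap.adjoint_inner_right]
  rw [Finset.sum_comm]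

variable [DecidableEq ι]

/-- The C*-seminorm on matrices over `B` given by a representation of `B`. -/
def matSeminorm (σ : Rep B) (ι : Type) [Fintype ι] [DecidableEq ι] :
    CStarSeminorm (CStarMatrix ι ι B) where
  toFun Y := ‖σ.matOp Y‖
  add_le Y Z := by rw [matOp_add]; exact norm_add_le _ _
  smul c Y := by rw [matOp_smul, norm_smul]
  mul_le Y Z := by rw [matOp_mul]; exact norm_mul_le _ _
  star_mul_self Y := by
    rw [matOp_mul]
    exact opNorm_adj_mul_self _ _ (σ.inner_matOp Y)

/-- A separating set for `B` also separates matrices over `B`, because vectors with one nonzero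
coordinate isolate the entries. It therefore determines the C*-norm of the matrix algebra, which
bounds the operator given by any other representation. -/
theorem norm_matOp_le {S : Set (Rep B)} (hS : Separating S) (σ : Rep B) (Y : CStarMatrix ι ι B)
    {C : ℝ} (hC : 0 ≤ C) (h : ∀ τ ∈ S, ‖τ.matOp Y‖ ≤ C) : ‖σ.matOp Y‖ ≤ C := by
  let _ := CStarAlgebra.spectralOrder B
  have := CStarAlgebra.spectralOrderedRing B
  refine ((σ.matSeminorm ι).le_norm Y).trans
    (CStarSeminorm.norm_le_of_separating (fun τ : S => τ.1.matSeminorm ι) (fun Z hZ => ?_) Y hC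
      fun τ => h τ.1 τ.2)
  ext i j
  refine hS _ fun τ hτ => ContinuousLinearMap.ext fun k => ?_
  have h0 : τ.matOp Z = 0 := norm_eq_zero.1 (hZ ⟨τ, hτ⟩)
  have h1 := τ.matOp_apply Z (WithLp.toLp 2 (Pi.single j k)) i
  rw [h0, Finset.sum_eq_single j] at h1
  · simpa using h1.symm
  · intro l _ hl
    simp [Pi.single_eq_of_ne hl]
  · simp

end matOp

section compress

variable {ι : Type} [Fintype ι]

/-- The vector `∑ i, e i ⊗ v i`. -/
def expand {H K : Type} [NormedAddCommGroup H] [InnerProductSpace ℂ H] [NormedAddCommGroup K]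
    [InnerProductSpace ℂ K] (e : ι → H) (v : PiLp 2 fun _ : ι => K) : H ⊗[ℂ] K :=
  ∑ i, e i ⊗ₜ v i

theorem norm_expand {H K : Type} [NormedAddCommGroup H] [InnerProductSpace ℂ H]
    [NormedAddCommGroup K] [InnerProductSpace ℂ K] {e : ι → H} (he : Orthonormal ℂ e)
    (v : PiLp 2 fun _ : ι => K) : ‖expand e v‖ = ‖v‖ := by
  classical
  have h : ip (expand e v) (expand e v) = ip v v := by
    change inner ℂ (expand e v) (expand e v) = inner ℂ v v
    simp only [expand, sum_inner, inner_sum, TensorProduct.inner_tmul, PiLp.inner_apply]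
    refine Finset.sum_congr rfl fun i _ => ?_
    simp [orthonormal_iff_ite.1 he]
  rw [ip_self, ip_self] at h
  have h' : ‖expand e v‖ ^ 2 = ‖v‖ ^ 2 := by exact_mod_cast h
  exact (sq_eq_sq₀ (norm_nonneg _) (norm_nonneg _)).1 h'

/-- Allowing every larger `F'` lets two vectors be expanded over one common orthonormal family, as
`exists_expand_pair` requires. -/
theorem exists_expand {H K : Type} [NormedAddCommGroup H] [InnerProductSpace ℂ H]
    [NormedAddCommGroup K] [InnerProductSpace ℂ K] (v : H ⊗[ℂ] K) :
    ∃ F : Submodule ℂ H, FiniteDimensional ℂ F ∧ ∀ (F' : Submodule ℂ H) [FiniteDimensional ℂ F'],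
      F ≤ F' → ∃ v' : PiLp 2 fun _ : Fin (Module.finrank ℂ F') => K,
        v = expand (fun i => (stdOrthonormalBasis ℂ F' i : H)) v' := by
  induction v using TensorProduct.induction_on with
  | zero => exact ⟨⊥, inferInstance, fun F' _ _ => ⟨0, by simp [expand]⟩⟩
  | tmul h k =>
    refine ⟨Submodule.span ℂ {h}, inferInstance, fun F' _ hF => ?_⟩
    have hh : h ∈ F' := hF (Submodule.mem_span_singleton_self h)
    refine ⟨WithLp.toLp 2 fun i => (stdOrthonormalBasis ℂ F').repr ⟨h, hh⟩ i • k, ?_⟩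
    have := congrArg Subtype.val ((stdOrthonormalBasis ℂ F').sum_repr ⟨h, hh⟩)
    simp only [Submodule.coe_sum, Submodule.coe_smul] at this
    conv_lhs => rw [← this]
    simp [expand, TensorProduct.sum_tmul, TensorProduct.smul_tmul]
  | add v w hv hw =>
    obtain ⟨F, _, hF⟩ := hv
    obtain ⟨G, _, hG⟩ := hw
    refine ⟨F ⊔ G, inferInstance, fun F' _ h => ?_⟩
    obtain ⟨v', hv'⟩ := hF F' (le_sup_left.trans h)
    obtain ⟨w', hw'⟩ := hG F' (le_sup_right.trans h)
    refine ⟨v' + w', ?_⟩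
    rw [hv', hw']
    simp [expand, TensorProduct.tmul_add, Finset.sum_add_distrib]

theorem exists_expand_pair {H K : Type} [NormedAddCommGroup H] [InnerProductSpace ℂ H]
    [NormedAddCommGroup K] [InnerProductSpace ℂ K] (v w : H ⊗[ℂ] K) :
    ∃ (n : ℕ) (e : Fin n → H) (v' w' : PiLp 2 fun _ : Fin n => K), Orthonormal ℂ e ∧
      v = expand e v' ∧ w = expand e w' := by
  obtain ⟨F, _, hF⟩ := exists_expand v
  obtain ⟨G, _, hG⟩ := exists_expand w
  obtain ⟨v', hv⟩ := hF (F ⊔ G) le_sup_left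
  obtain ⟨w', hw⟩ := hG (F ⊔ G) le_sup_right
  have ho := (stdOrthonormalBasis ℂ (F ⊔ G : Submodule ℂ H)).orthonormal
  exact ⟨_, _, v', w', ho.comp_linearIsometry (F ⊔ G).subtypeₗᵢ, hv, hw⟩

/-- The compression of an element of `A ⊙ B` to a matrix over `B`, given by a representation of
`A` and vectors in its Hilbert space. -/
def compress (ρ : Rep A) (e : ι → ρ.H) (B : Type) [CStarAlgebra B] (i j : ι) : A ⊗[ℂ] B →ₗ[ℂ] B :=
  TensorProduct.lift (LinearMap.mk₂ ℂ (fun a b => (inner ℂ (e i) (ρ.π a (e j)) : ℂ) • b)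
    (fun a a' b => by simp [add_smul])
    (fun c a b => by simp [mul_smul])
    (fun a b b' => by simp) (fun c a b => by rw [smul_comm]))

/-- The matrix of all compressions. -/
def compressMat (ρ : Rep A) (e : ι → ρ.H) (x : A ⊗[ℂ] B) : CStarMatrix ι ι B :=
  CStarMatrix.ofMatrix fun i j => ρ.compress e B i j x

theorem compressMat_apply {ι : Type} (ρ : Rep A) (e : ι → ρ.H) (x : A ⊗[ℂ] B) (i j : ι) :
    ρ.compressMat e x i j = ρ.compress e B i j x := rfl

/-- On the span of the vectors `e i ⊗ k`, the matrix coefficients of `ρ ⊗ σ` only involve the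
scalars `⟪e i, ρ(a) e j⟫`. The first leg can thus be integrated out, leaving a matrix over `B` that
does not depend on `σ`. -/
theorem inner_expand (ρ : Rep A) (σ : Rep B) (e : ι → ρ.H) (x : A ⊗[ℂ] B)
    (v w : PiLp 2 fun _ : ι => σ.H) :
    ip (expand e w) (ρ.tensorOp σ x (expand e v)) = ip w (σ.matOp (ρ.compressMat e x) v) := by
  induction x using TensorProduct.induction_on with
  | zero => simp [ip, PiLp.inner_apply, matOp_apply, compressMat_apply]
  | add x y hx hy =>
    have h : ρ.compressMat e (x + y) = ρ.compressMat e x + ρ.compressMat e y := by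
      ext i j
      exact (ρ.compress e B i j).map_add x y
    rw [map_add, add_apply, ip_add_right, hx, hy, ← ip_add_right, ← add_apply,
      ← matOp_add, h]
  | tmul a b =>
    change inner ℂ _ _ = inner ℂ _ _
    simp only [expand, map_sum, tensorOp_tmul, sum_inner, inner_sum, PiLp.inner_apply,
      matOp_apply, TensorProduct.mapL_tmul, TensorProduct.inner_tmul, compress, compressMat_apply]
    rw [Finset.sum_comm]
    refine Finset.sum_congr rfl fun i _ => Finset.sum_congr rfl fun j _ => ?_
    simp [inner_smul_right]

end compress

theorem norm_matOp_compressMat_le (ρ : Rep A) (σ : Rep B) {n : ℕ} {e : Fin n → ρ.H}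
    (he : Orthonormal ℂ e) (x : A ⊗[ℂ] B) : ‖σ.matOp (ρ.compressMat e x)‖ ≤ ρ.tensorNorm σ x := by
  refine opNorm_le_of_inner _ (tensorNorm_nonneg _ _ _) fun v w => ?_
  rw [← inner_expand, ← norm_expand he v, ← norm_expand he w]
  refine (norm_ip_le _ _).trans ?_
  have h1 := mul_le_mul_of_nonneg_left (ρ.norm_tensorOp_apply_le σ x (expand e v))
    (norm_nonneg (expand e w))
  exact h1.trans_eq (by ring)

/-- Any two vectors of `H ⊙ K` lie in `F ⊙ K` for one finite-dimensional `F`, so the compressions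
exhaust the norm. -/
theorem tensorNorm_le_of_matOp (ρ : Rep A) (σ : Rep B) (x : A ⊗[ℂ] B) {C : ℝ} (hC : 0 ≤ C)
    (h : ∀ (n : ℕ) (e : Fin n → ρ.H), Orthonormal ℂ e → ‖σ.matOp (ρ.compressMat e x)‖ ≤ C) :
    ρ.tensorNorm σ x ≤ C := by
  refine ρ.tensorNorm_le_of_ip σ x hC fun v w => ?_
  obtain ⟨n, e, v', w', ho, hv, hw⟩ := exists_expand_pair v w
  rw [hv, hw, inner_expand ρ σ e x v' w', norm_expand ho v', norm_expand ho w']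
  refine (norm_ip_le _ _).trans ?_
  have h0 : ‖σ.matOp (ρ.compressMat e x) v'‖ ≤ C * ‖v'‖ :=
    (ContinuousLinearMap.le_opNorm _ v').trans
      (mul_le_mul_of_nonneg_right (h n e ho) (norm_nonneg _))
  have h1 := mul_le_mul_of_nonneg_left h0 (norm_nonneg w')
  exact h1.trans_eq (by ring)

/-- The norm of `(ρ ⊗ σ)(x)` is controlled by the norms of `(ρ ⊗ τ)(x)` for a separating set of
representations `τ`. -/
theorem tensorNorm_le_right {S : Set (Rep B)} (hS : Separating S) (ρ : Rep A) (σ : Rep B)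
    (x : A ⊗[ℂ] B) {C : ℝ} (hC : 0 ≤ C) (h : ∀ τ ∈ S, ρ.tensorNorm τ x ≤ C) :
    ρ.tensorNorm σ x ≤ C :=
  ρ.tensorNorm_le_of_matOp σ x hC fun _ _ he => norm_matOp_le hS σ _ hC fun τ hτ =>
    (ρ.norm_matOp_compressMat_le τ he x).trans (h τ hτ)

/-- The flip is an isometry that intertwines the two product representations; through it the
estimate for the right factor carries over to the left factor. -/
theorem tensorOp_comm (ρ : Rep A) (σ : Rep B) (x : A ⊗[ℂ] B) (v : ρ.H ⊗[ℂ] σ.H) :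
    (σ.tensorOp ρ) (TensorProduct.comm ℂ A B x) (TensorProduct.comm ℂ ρ.H σ.H v) =
      TensorProduct.comm ℂ ρ.H σ.H ((ρ.tensorOp σ) x v) := by
  induction x using TensorProduct.induction_on with
  | zero => simp
  | add x y hx hy =>
    rw [map_add, map_add, map_add, add_apply, add_apply,
      hx, hy, map_add]
  | tmul a b =>
    rw [TensorProduct.comm_tmul, tensorOp_tmul, tensorOp_tmul]
    induction v using TensorProduct.induction_on with
    | zero => simp
    | add v w hv hw => simp only [map_add, hv, hw]
    | tmul h k =>
      rw [TensorProduct.comm_tmul]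
      exact (TensorProduct.mapL_tmul ..).trans
        (congrArg (TensorProduct.comm ℂ ρ.H σ.H) (TensorProduct.mapL_tmul ..).symm)

theorem tensorNorm_comm_le (ρ : Rep A) (σ : Rep B) (x : A ⊗[ℂ] B) :
    ρ.tensorNorm σ x ≤ σ.tensorNorm ρ (TensorProduct.comm ℂ A B x) := by
  refine ρ.tensorNorm_le σ x (tensorNorm_nonneg _ _ _) fun v => ?_
  have h1 := σ.norm_tensorOp_apply_le ρ (TensorProduct.comm ℂ A B x)
    (TensorProduct.comm ℂ ρ.H σ.H v)
  rw [tensorOp_comm] at h1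
  exact (TensorProduct.norm_comm (𝕜 := ℂ) (E := ρ.H) (F := σ.H) _).symm.trans_le
    (h1.trans_eq (congrArg _ (TensorProduct.norm_comm (𝕜 := ℂ) (E := ρ.H) (F := σ.H) _)))

theorem tensorNorm_comm (ρ : Rep A) (σ : Rep B) (x : A ⊗[ℂ] B) :
    σ.tensorNorm ρ (TensorProduct.comm ℂ A B x) = ρ.tensorNorm σ x := by
  refine le_antisymm ((tensorNorm_comm_le σ ρ _).trans_eq ?_) (tensorNorm_comm_le ρ σ x)
  rw [TensorProduct.comm_comm]

theorem tensorNorm_le_left {S : Set (Rep A)} (hS : Separating S) (ρ : Rep A) (σ : Rep B)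
    (x : A ⊗[ℂ] B) {C : ℝ} (hC : 0 ≤ C) (h : ∀ τ ∈ S, τ.tensorNorm σ x ≤ C) :
    ρ.tensorNorm σ x ≤ C := by
  rw [← tensorNorm_comm]
  refine tensorNorm_le_right hS σ ρ _ hC fun τ hτ => ?_
  rw [tensorNorm_comm]
  exact h τ hτ

/-- The minimal norm can be computed from separating sets of representations of the factors. -/
theorem minNorm_le {S : Set (Rep A)} (hS : Separating S) {T : Set (Rep B)} (hT : Separating T)
    (x : A ⊗[ℂ] B) {C : ℝ} (hC : 0 ≤ C)
    (h : ∀ ρ ∈ S, ∀ σ ∈ T, ρ.tensorNorm σ x ≤ C) : (minNorm A B).toFun x ≤ C := by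
  refine Real.iSup_le (fun r => ?_) hC
  exact tensorNorm_le_left hS ⟨r.H, r.ξ⟩ ⟨r.K, r.η⟩ x hC fun ρ hρ =>
    tensorNorm_le_right hT ρ _ x hC fun σ hσ => h ρ hρ σ hσ

theorem tensorNorm_le_minNorm (ρ : Rep A) (σ : Rep B) (x : A ⊗[ℂ] B) :
    ρ.tensorNorm σ x ≤ (minNorm A B).toFun x :=
  le_ciSup (RepPair.bddAbove x) (ρ.pair σ)

end Rep

/-! ### *-polynomials and the domination of pairs. -/

namespace FreeStar

variable {X : Type}

/-- To prove a property of *-polynomials it suffices to prove it for the generators and their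
adjoints, and that it is preserved by the operations of an algebra. -/
theorem induction {P : FreeStar X → Prop} (a : FreeStar X) (hgen : ∀ x, P (gen x))
    (hstar : ∀ x, P (star (gen x))) (hone : P 1) (hmul : ∀ a b, P a → P b → P (a * b))
    (hadd : ∀ a b, P a → P b → P (a + b)) (hsmul : ∀ (c : ℂ) a, P a → P (c • a)) : P a := by
  induction a using ind with
  | hadd a b ha hb => exact hadd a b ha hb
  | hm w c =>
    have h : P (mono w 1) := by
      induction w using FreeMonoid.inductionOn' with
      | one => exact hone
      | of_mul x w ih =>
        rw [← mul_one (1 : ℂ), ← mono_mul]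
        refine hmul _ _ ?_ ih
        rcases x with x | x
        · exact hgen x
        · have := hstar x
          rw [gen, star_mono, star_one] at this
          exact this
    rw [← mul_one c, ← smul_mono]
    exact hsmul c _ h

/-- Only an algebra homomorphism is required, with adjoints checked on the generators, so that
`Algebra.TensorProduct.map` is covered. -/
theorem map_eval {D D' : Type*} [Ring D] [StarRing D] [Algebra ℂ D] [StarModule ℂ D] [Ring D']
    [StarRing D'] [Algebra ℂ D'] [StarModule ℂ D'] (φ : D →ₐ[ℂ] D') {f : X → D} {g : X → D'}
    (h : ∀ x, φ (f x) = g x) (hs : ∀ x, φ (star (f x)) = star (g x)) (a : FreeStar X) :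
    φ (eval f a) = eval g a := by
  induction a using induction with
  | hgen x => rw [eval_gen, eval_gen, h]
  | hstar x => rw [map_star (eval f), map_star (eval g), eval_gen, eval_gen, hs]
  | hone => simp only [map_one]
  | hmul a b ha hb => simp only [map_mul, ha, hb]
  | hadd a b ha hb => simp only [map_add, ha, hb]
  | hsmul c a ha => simp only [map_smul, ha]

theorem map_eval_star {D D' : Type*} [Ring D] [StarRing D] [Algebra ℂ D] [StarModule ℂ D]
    [Ring D'] [StarRing D'] [Algebra ℂ D'] [StarModule ℂ D'] (φ : D →⋆ₐ[ℂ] D') {f : X → D}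
    {g : X → D'} (h : ∀ x, φ (f x) = g x) (a : FreeStar X) : φ (eval f a) = eval g a :=
  map_eval φ.toAlgHom h (fun x => (map_star φ _).trans (congrArg star (h x))) a

theorem eval_toCompl_gen (p : CStarSeminorm (FreeStar X)) (a : FreeStar X) :
    eval (fun x => p.toCompl (gen x)) a = p.toCompl a := by
  rw [← map_eval_star p.toCompl (f := gen) fun x => rfl]
  congr 1
  induction a using induction with
  | hgen x => rw [eval_gen]
  | hstar x => rw [map_star, eval_gen]
  | hone => simp only [map_one]
  | hmul a b ha hb => simp only [map_mul, ha, hb]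
  | hadd a b ha hb => simp only [map_add, ha, hb]
  | hsmul c a ha => simp only [map_smul, ha]

end FreeStar

/-- A family of *-homomorphisms that determines the norm on a dense subset separates points. -/
theorem eq_zero_of_dense {ι : Sort*} {B : Type*} [CStarAlgebra B] {D : ι → Type*}
    [∀ i, CStarAlgebra (D i)] (φ : ∀ i, B →⋆ₐ[ℂ] D i) {s : Set B} (hs : Dense s)
    (h : ∀ x ∈ s, ∀ C : ℝ, 0 ≤ C → (∀ i, ‖φ i x‖ ≤ C) → ‖x‖ ≤ C) (a : B)
    (ha : ∀ i, φ i a = 0) : a = 0 := by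
  rw [← norm_le_zero_iff]
  refine le_of_forall_pos_le_add fun ε hε => ?_
  obtain ⟨x, hx, hxa⟩ := Metric.mem_closure_iff.1 (hs a) (ε / 2) (half_pos hε)
  rw [dist_eq_norm] at hxa
  -- Since every `φ i` kills `a`, it sees only the small difference of `x` and `a`; the norm of the
  -- dense element `x` is determined by these values.
  have h1 : ‖x‖ ≤ ε / 2 := h x hx _ (half_pos hε).le fun i => by
    have h2 : φ i x = -φ i (a - x) := by rw [map_sub, ha, zero_sub, neg_neg]
    rw [h2, norm_neg]
    exact (NonUnitalStarAlgHom.norm_apply_le (φ i) _).trans hxa.le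
  have h2 := norm_add_le (a - x) x
  rw [sub_add_cancel] at h2
  linarith

namespace Rep

variable {A B A' B' : Type} [CStarAlgebra A] [CStarAlgebra B] [CStarAlgebra A'] [CStarAlgebra B']

theorem tensorNorm_comp (ρ : Rep A') (σ : Rep B') (φ : A →⋆ₐ[ℂ] A') (ψ : B →⋆ₐ[ℂ] B')
    (x : A ⊗[ℂ] B) : (ρ.comp φ).tensorNorm (σ.comp ψ) x =
      ρ.tensorNorm σ (Algebra.TensorProduct.map φ.toAlgHom ψ.toAlgHom x) := by
  have h : (ρ.comp φ).tensorOp (σ.comp ψ) x =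
      ρ.tensorOp σ (Algebra.TensorProduct.map φ.toAlgHom ψ.toAlgHom x) := by
    induction x using TensorProduct.induction_on with
    | zero => rw [map_zero, map_zero, map_zero]; rfl
    | add x y hx hy => rw [map_add, map_add, map_add, hx, hy]; rfl
    | tmul a b => exact (tensorOp_tmul ..).trans (tensorOp_tmul ρ σ (φ a) (ψ b)).symm
  exact congrArg (fun T : ρ.H ⊗[ℂ] σ.H →L[ℂ] ρ.H ⊗[ℂ] σ.H => ‖T‖) h

theorem separating_of_homs {ι : Sort*} {D : ι → Type} [∀ i, CStarAlgebra (D i)]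
    (φ : ∀ i, A →⋆ₐ[ℂ] D i) (h : ∀ a, (∀ i, φ i a = 0) → a = 0) :
    Separating {ρ : Rep A | ∃ i, ∃ τ : Rep (D i), ρ = τ.comp (φ i)} := fun a ha =>
  h a fun i => separating_univ _ fun τ _ => ha _ ⟨i, τ, rfl⟩

end Rep

namespace MatPair

variable {N : ℕ}

/-- The evaluation of *-polynomials in `N²` variables at the entries of the matrix. -/
def ev (P : MatPair N) : FreeStar (Fin N × Fin N) →⋆ₐ[ℂ] P.D :=
  FreeStar.eval fun ij => P.M ij.1 ij.2

/-- The pair `P` is dominated by a family of pairs: on the entries of their matrices, every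
*-polynomial has norm at most the supremum of its norms for the family. -/
def Dominated {ι : Sort*} (P : MatPair N) (Q : ι → MatPair N) : Prop :=
  ∀ f C, 0 ≤ C → (∀ i, ‖(Q i).ev f‖ ≤ C) → ‖P.ev f‖ ≤ C

/-- The pair `P` is dominated by the pair `Q`. -/
def Le (P Q : MatPair N) : Prop := ∀ f, ‖P.ev f‖ ≤ ‖Q.ev f‖

theorem Le.trans {P Q R : MatPair N} (h : P.Le Q) (h' : Q.Le R) : P.Le R :=
  fun f => (h f).trans (h' f)

theorem Le.refl (P : MatPair N) : P.Le P := fun _ => le_rfl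

theorem Le.dominated {P Q : MatPair N} (h : P.Le Q) : P.Dominated fun _ : Unit => Q :=
  fun f _ _ hi => (h f).trans (hi ())

theorem Arrow.map_ev {P Q : MatPair N} (φ : P.Arrow Q) (f : FreeStar (Fin N × Fin N)) :
    φ.hom (P.ev f) = Q.ev f :=
  FreeStar.map_eval_star (f := fun ij : Fin N × Fin N => P.M ij.1 ij.2)
    (g := fun ij : Fin N × Fin N => Q.M ij.1 ij.2) φ.hom (fun ij => φ.map_entry ij.1 ij.2) f

theorem Arrow.le {P Q : MatPair N} (φ : P.Arrow Q) : Q.Le P := fun f => by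
  rw [← φ.map_ev]
  exact NonUnitalStarAlgHom.norm_apply_le φ.hom _

theorem Arrow.le_of_injective {P Q : MatPair N} (φ : P.Arrow Q) (h : Function.Injective φ.hom) :
    P.Le Q := fun f => by
  rw [← φ.map_ev, NonUnitalStarAlgHom.norm_map φ.hom h]

theorem le_cut (P : MatPair N) : P.Le P.cut :=
  Arrow.le ⟨P.entryAlg.subtype, fun _ _ => rfl⟩

theorem cut_le (P : MatPair N) : P.cut.Le P :=
  Arrow.le_of_injective ⟨P.entryAlg.subtype, fun _ _ => rfl⟩ Subtype.val_injective

/-- The evaluation of *-polynomials at the entries of `P ⊥ Q` in the algebraic tensor product. -/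
def evTensor (P Q : MatPair N) : FreeStar (Fin N × Fin N) →⋆ₐ[ℂ] P.D ⊗[ℂ] Q.D :=
  FreeStar.eval fun ij => ∑ k, P.M ij.1 k ⊗ₜ Q.M k ij.2

theorem toCompl_evTensor (P Q : MatPair N) (f : FreeStar (Fin N × Fin N)) :
    (minNorm P.D Q.D).toCompl (P.evTensor Q f) = (P.oprod Q).ev f :=
  FreeStar.map_eval_star _ (fun _ => map_sum _ _ _) f

theorem norm_ev_oprod (P Q : MatPair N) (f : FreeStar (Fin N × Fin N)) :
    ‖(P.oprod Q).ev f‖ = (minNorm P.D Q.D).toFun (P.evTensor Q f) := by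
  rw [← toCompl_evTensor]
  exact CStarSeminorm.norm_coe _ _

theorem Arrow.map_evTensor {P P' Q Q' : MatPair N} (φ : P.Arrow P') (ψ : Q.Arrow Q')
    (f : FreeStar (Fin N × Fin N)) :
    Algebra.TensorProduct.map φ.hom.toAlgHom ψ.hom.toAlgHom (P.evTensor Q f) =
      P'.evTensor Q' f := by
  refine FreeStar.map_eval _ (fun ij => ?_) (fun ij => ?_) f
  · rw [map_sum]
    refine Finset.sum_congr rfl fun k _ => ?_
    rw [Algebra.TensorProduct.map_tmul]
    exact congrArg₂ _ (φ.map_entry _ _) (ψ.map_entry _ _)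
  · rw [star_sum, star_sum, map_sum]
    refine Finset.sum_congr rfl fun k _ => ?_
    rw [TensorProduct.star_tmul, TensorProduct.star_tmul, Algebra.TensorProduct.map_tmul]
    exact congrArg₂ _ ((map_star φ.hom _).trans (congrArg star (φ.map_entry _ _)))
      ((map_star ψ.hom _).trans (congrArg star (ψ.map_entry _ _)))

section limit

variable {ι : Sort*} (P : ι → MatPair N) (hP : ∀ i j, ∃ C : ℝ, ∀ n, ‖(P n).M i j‖ ≤ C)

/-- The supremum of the C*-seminorms of a family of pairs. -/
def supSeminorm : CStarSeminorm (FreeStar (Fin N × Fin N)) :=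
  CStarSeminorm.iSup (fun n => CStarSeminorm.ofHom
      (FreeStar.eval fun ij : Fin N × Fin N => (P n).M ij.1 ij.2))
    (FreeStar.bddAbove_eval (fun n (ij : Fin N × Fin N) => (P n).M ij.1 ij.2)
      fun ij => hP ij.1 ij.2)

/-- The smallest pair that dominates all members of a family of pairs. -/
def supPair : MatPair N where
  D := (supSeminorm P hP).Compl
  M := Matrix.of fun i j => CStarSeminorm.toCompl _ (FreeStar.gen (i, j))

theorem supPair_ev (f : FreeStar (Fin N × Fin N)) :
    (supPair P hP).ev f = (supSeminorm P hP).toCompl f :=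
  FreeStar.eval_toCompl_gen _ f

theorem norm_supPair_ev (f : FreeStar (Fin N × Fin N)) :
    ‖(supPair P hP).ev f‖ = (supSeminorm P hP).toFun f := by
  rw [supPair_ev]
  exact CStarSeminorm.norm_coe _ _

theorem supPair_dominated : (supPair P hP).Dominated P := fun f C hC h => by
  rw [norm_supPair_ev]
  exact Real.iSup_le h hC

theorem le_supPair (n : ι) : (P n).Le (supPair P hP) := fun f => by
  rw [norm_supPair_ev]
  exact le_ciSup (FreeStar.bddAbove_eval (fun n (ij : Fin N × Fin N) => (P n).M ij.1 ij.2)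
      (fun ij => hP ij.1 ij.2) f) n

theorem dense_supPair : Dense (Set.range (supPair P hP).ev) := by
  have h := (supSeminorm P hP).denseRange_coe
  refine h.mono ?_
  rintro _ ⟨f, rfl⟩
  exact ⟨f, supPair_ev P hP f⟩

/-- Here norm inequalities become homomorphisms: evaluation at `Q` is bounded by the seminorm that
defines the completion. The comultiplication and the arrow to `C(S_N)` both arise in this way. -/
theorem exists_arrow_of_le {Q : MatPair N} (h : Q.Le (supPair P hP)) :
    Nonempty ((supPair P hP).Arrow Q) := by
  obtain ⟨ψ, hψ⟩ := (supSeminorm P hP).exists_lift Q.ev fun f => by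
    rw [← norm_supPair_ev]; exact h f
  exact ⟨ψ, fun i j => (hψ _).trans (FreeStar.eval_gen _ _)⟩

theorem Dominated.le_supPair {P : ι → MatPair N} {Q : MatPair N} (h : Q.Dominated P)
    (hP : ∀ i j, ∃ C : ℝ, ∀ n, ‖(P n).M i j‖ ≤ C) : Q.Le (supPair P hP) := fun f =>
  h f _ (norm_nonneg _) fun n => MatPair.le_supPair P hP n f

/-- On the dense set of *-polynomials the norm is the supremum of the norms in the members `P n`, so
the arrows to the members jointly detect zero. -/
theorem separating_supPair (φ : ∀ n, (supPair P hP).Arrow (P n)) :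
    Rep.Separating {ρ : Rep (supPair P hP).D |
      ∃ n, ∃ τ : Rep (P n).D, ρ = τ.comp (φ n).hom} := by
  refine Rep.separating_of_homs (fun n => (φ n).hom)
    (eq_zero_of_dense _ (dense_supPair P hP) ?_)
  rintro _ ⟨f, rfl⟩ C hC h
  exact supPair_dominated P hP f C hC fun n => by rw [← (φ n).map_ev]; exact h n

end limit

/-- Domination is compatible with products of pairs. -/
theorem Dominated.oprod {ι κ : Type*} {P Q : MatPair N} {P' : ι → MatPair N}
    {Q' : κ → MatPair N} (hP : P.Dominated P') (hQ : Q.Dominated Q')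
    (bP : ∀ i j, ∃ C : ℝ, ∀ n, ‖(P' n).M i j‖ ≤ C)
    (bQ : ∀ i j, ∃ C : ℝ, ∀ n, ‖(Q' n).M i j‖ ≤ C) :
    (P.oprod Q).Dominated fun nm : ι × κ => (P' nm.1).oprod (Q' nm.2) := by
  intro f C hC h
  rw [norm_ev_oprod]
  obtain ⟨φ⟩ := exists_arrow_of_le P' bP (hP.le_supPair bP)
  obtain ⟨ψ⟩ := exists_arrow_of_le Q' bQ (hQ.le_supPair bQ)
  have φ' := fun n => (exists_arrow_of_le P' bP (MatPair.le_supPair P' bP n)).some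
  have ψ' := fun n => (exists_arrow_of_le Q' bQ (MatPair.le_supPair Q' bQ n)).some
  refine Rep.minNorm_le Rep.separating_univ Rep.separating_univ _ hC fun ρ _ σ _ => ?_
  -- Pull `ρ` and `σ` back to the sup pairs of the two families. There the representations that
  -- factor through single members are separating, so each leg can be replaced by a member.
  rw [← φ.map_evTensor ψ, ← Rep.tensorNorm_comp]
  refine Rep.tensorNorm_le_left (separating_supPair P' bP φ') _ _ _ hC ?_
  rintro _ ⟨n, τ, rfl⟩
  refine Rep.tensorNorm_le_right (separating_supPair Q' bQ ψ') _ _ _ hC ?_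
  rintro _ ⟨m, υ, rfl⟩
  rw [Rep.tensorNorm_comp, (φ' n).map_evTensor (ψ' m)]
  refine (Rep.tensorNorm_le_minNorm _ _ _).trans ?_
  rw [← norm_ev_oprod]
  exact h (n, m)

theorem Le.oprod {P Q P' Q' : MatPair N} (hP : P.Le P') (hQ : Q.Le Q') :
    (P.oprod Q).Le (P'.oprod Q') := fun f =>
  hP.dominated.oprod hQ.dominated (fun i j => ⟨‖P'.M i j‖, fun _ => le_rfl⟩)
    (fun i j => ⟨‖Q'.M i j‖, fun _ => le_rfl⟩) f _ (norm_nonneg _) fun _ => le_rfl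

theorem le_foldl {l l' : List (MatPair N)} (h : List.Forall₂ Le l l') {P P' : MatPair N}
    (hP : P.Le P') : (l.foldl MatPair.oprod P).Le (l'.foldl MatPair.oprod P') := by
  induction h generalizing P P' with
  | nil => exact hP
  | cons hQ _ ih => exact ih (hP.oprod hQ)

theorem le_listProd {l l' : List (MatPair N)} (h : List.Forall₂ Le l l') :
    (listProd l).Le (listProd l') := by
  cases h with
  | nil => exact Le.refl _
  | cons hP h => exact le_foldl h hP

end MatPair

/-! ### Products of representations and associativity of the minimal tensor product. -/

/-- `CStarSeminorm.exists_lift` for representations on Hilbert spaces. -/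
theorem CStarSeminorm.exists_lift_operator {R : Type*} [Ring R] [StarRing R] [Algebra ℂ R]
    [StarModule ℂ R] (p : CStarSeminorm R) {H : Type*} [NormedAddCommGroup H]
    [InnerProductSpace ℂ H] [CompleteSpace H] (φ : R →⋆ₐ[ℂ] (H →L[ℂ] H))
    (h : ∀ x, ‖φ x‖ ≤ p.toFun x) :
    ∃ ψ : p.Compl →⋆ₐ[ℂ] (H →L[ℂ] H), ∀ x, ψ (p.toCompl x) = φ x :=
  p.exists_lift φ h

namespace Rep

variable {A B : Type} [CStarAlgebra A] [CStarAlgebra B]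

open UniformSpace (Completion)

/-- The product representation of the algebraic tensor product on the Hilbert space completion. -/
def tensorHom (ρ : Rep A) (σ : Rep B) :
    A ⊗[ℂ] B →⋆ₐ[ℂ]
      (Completion (ρ.H ⊗[ℂ] σ.H) →L[ℂ] Completion (ρ.H ⊗[ℂ] σ.H)) where
  toFun x := (ρ.tensorOp σ x).completion
  map_one' := by
    ext v
    induction v using Completion.induction_on with
    | hp => exact isClosed_eq (by fun_prop) (by fun_prop)
    | ih v => rw [ContinuousLinearMap.completion_apply_coe, map_one]; rfl
  map_mul' x y := by
    ext v
    induction v using Completion.induction_on with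
    | hp => exact isClosed_eq (by fun_prop) (by fun_prop)
    | ih v =>
      rw [mul_apply_eq_comp, ContinuousLinearMap.completion_apply_coe,
        ContinuousLinearMap.completion_apply_coe, ContinuousLinearMap.completion_apply_coe, map_mul]
      rfl
  map_zero' := by
    ext v
    induction v using Completion.induction_on with
    | hp => exact isClosed_eq (by fun_prop) (by fun_prop)
    | ih v => rw [ContinuousLinearMap.completion_apply_coe, map_zero]; rfl
  map_add' x y := by
    ext v
    induction v using Completion.induction_on with
    | hp => exact isClosed_eq (by fun_prop) (by fun_prop)
    | ih v =>
      rw [add_apply, ContinuousLinearMap.completion_apply_coe,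
        ContinuousLinearMap.completion_apply_coe, ContinuousLinearMap.completion_apply_coe, map_add,
        add_apply, Completion.coe_add]
  commutes' c := by
    ext v
    induction v using Completion.induction_on with
    | hp => exact isClosed_eq (by fun_prop) (by fun_prop)
    | ih v =>
      rw [ContinuousLinearMap.completion_apply_coe, AlgHom.commutes,
        Algebra.algebraMap_eq_smul_one, Algebra.algebraMap_eq_smul_one]
      exact Completion.coe_smul c v
  map_star' x := by
    rw [ContinuousLinearMap.star_eq_adjoint]
    refine (ContinuousLinearMap.eq_adjoint_iff _ _).2 fun v w => ?_
    induction v, w using Completion.induction_on₂ with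
    | hp => exact isClosed_eq (by fun_prop) (by fun_prop)
    | ih v w =>
      rw [ContinuousLinearMap.completion_apply_coe, ContinuousLinearMap.completion_apply_coe,
        Completion.inner_coe, Completion.inner_coe]
      have h := ρ.inner_tensorOp σ (star x) v w
      rw [star_star] at h
      exact h

theorem tensorHom_apply_coe (ρ : Rep A) (σ : Rep B) (x : A ⊗[ℂ] B) (v : ρ.H ⊗[ℂ] σ.H) :
    ρ.tensorHom σ x (v : Completion (ρ.H ⊗[ℂ] σ.H)) =
      ((ρ.tensorOp σ x v : ρ.H ⊗[ℂ] σ.H) : Completion (ρ.H ⊗[ℂ] σ.H)) :=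
  ContinuousLinearMap.completion_apply_coe _ v

theorem norm_tensorHom_le (ρ : Rep A) (σ : Rep B) (x : A ⊗[ℂ] B) :
    ‖ρ.tensorHom σ x‖ ≤ ρ.tensorNorm σ x := by
  refine ContinuousLinearMap.opNorm_le_bound _ (tensorNorm_nonneg _ _ _) fun v => ?_
  induction v using Completion.induction_on with
  | hp => exact isClosed_le (by fun_prop) (by fun_prop)
  | ih v =>
    rw [tensorHom_apply_coe, Completion.norm_coe, Completion.norm_coe]
    exact norm_tensorOp_apply_le ..

theorem tensorNorm_le_norm_tensorHom (ρ : Rep A) (σ : Rep B) (x : A ⊗[ℂ] B) :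
    ρ.tensorNorm σ x ≤ ‖ρ.tensorHom σ x‖ := by
  refine ρ.tensorNorm_le σ x (ContinuousLinearMap.opNorm_nonneg _) fun v => ?_
  have h := (ρ.tensorHom σ x).le_opNorm (v : Completion (ρ.H ⊗[ℂ] σ.H))
  rwa [tensorHom_apply_coe, Completion.norm_coe, Completion.norm_coe] at h

theorem exists_tensor (ρ : Rep A) (σ : Rep B) :
    ∃ π : MinTensor A B →⋆ₐ[ℂ]
      (Completion (ρ.H ⊗[ℂ] σ.H) →L[ℂ] Completion (ρ.H ⊗[ℂ] σ.H)),
      ∀ x, π ((minNorm A B).toCompl x) = ρ.tensorHom σ x :=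
  (minNorm A B).exists_lift_operator (ρ.tensorHom σ) fun x =>
    (ρ.norm_tensorHom_le σ x).trans (ρ.tensorNorm_le_minNorm σ x)

/-- The product of two representations, as a representation of the minimal tensor product. -/
def tensor (ρ : Rep A) (σ : Rep B) : Rep (MinTensor A B) :=
  ⟨Completion (ρ.H ⊗[ℂ] σ.H), (ρ.exists_tensor σ).choose⟩

theorem tensor_toCompl (ρ : Rep A) (σ : Rep B) (x : A ⊗[ℂ] B) :
    (ρ.tensor σ).π ((minNorm A B).toCompl x) = ρ.tensorHom σ x :=
  (ρ.exists_tensor σ).choose_spec x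

/-- The inclusion of the algebraic tensor product of the Hilbert spaces. -/
def incl (ρ : Rep A) (σ : Rep B) : ρ.H ⊗[ℂ] σ.H →ₗᵢ[ℂ] (ρ.tensor σ).H :=
  Completion.toComplₗᵢ

theorem denseRange_incl (ρ : Rep A) (σ : Rep B) : DenseRange (ρ.incl σ) :=
  Completion.denseRange_coe

theorem tensor_tmul_incl (ρ : Rep A) (σ : Rep B) (a : A) (b : B) (v : ρ.H ⊗[ℂ] σ.H) :
    (ρ.tensor σ).π (tmul a b) (ρ.incl σ v) =
      ρ.incl σ (TensorProduct.map (ρ.π a : ρ.H →ₗ[ℂ] ρ.H) (σ.π b : σ.H →ₗ[ℂ] σ.H) v) := by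
  have h := congrArg (fun T => T (ρ.incl σ v)) (ρ.tensor_toCompl σ (a ⊗ₜ b))
  refine h.trans ((ρ.tensorHom_apply_coe σ _ v).trans ?_)
  rw [tensorOp_tmul]
  exact congrArg (ρ.incl σ) (TensorProduct.mapL_apply ..)

/-- On the dense image of the algebraic tensor product the norm is, by definition, the supremum over
product representations. -/
theorem separating_tensor :
    Separating {τ : Rep (MinTensor A B) | ∃ (ρ : Rep A) (σ : Rep B), τ = ρ.tensor σ} := by
  intro z hz
  refine eq_zero_of_dense (fun r : Rep A × Rep B => (r.1.tensor r.2).π)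
    (minNorm A B).denseRange_coe ?_ z fun r => hz _ ⟨r.1, r.2, rfl⟩
  rintro _ ⟨x, rfl⟩ C hC h
  rw [CStarSeminorm.norm_coe]
  refine minNorm_le separating_univ separating_univ x hC fun ρ _ σ _ => ?_
  refine (ρ.tensorNorm_le_norm_tensorHom σ x).trans ?_
  rw [← tensor_toCompl]
  exact h (ρ, σ)

section assoc

variable {C : Type} [CStarAlgebra C] (ρ : Rep A) (σ : Rep B) (τ : Rep C)

/-- The inclusion `H ⊙ (K ⊙ L) → H ⊙ (K ⊗ L)`. -/
def inclRight : ρ.H ⊗[ℂ] (σ.H ⊗[ℂ] τ.H) →ₗᵢ[ℂ] ρ.H ⊗[ℂ] (σ.tensor τ).H :=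
  (σ.incl τ).lTensor ρ.H

/-- The inclusion `H ⊙ (K ⊙ L) ≅ (H ⊙ K) ⊙ L → (H ⊗ K) ⊙ L`. -/
def inclLeft : ρ.H ⊗[ℂ] (σ.H ⊗[ℂ] τ.H) →ₗᵢ[ℂ] (ρ.tensor σ).H ⊗[ℂ] τ.H :=
  ((ρ.incl σ).rTensor τ.H).comp (TensorProduct.assocIsometry ℂ ρ.H σ.H τ.H).symm.toLinearIsometry

theorem inclRight_tmul (h : ρ.H) (v : σ.H ⊗[ℂ] τ.H) :
    inclRight ρ σ τ (h ⊗ₜ v) = h ⊗ₜ σ.incl τ v := rfl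

theorem inclLeft_tmul (h : ρ.H) (k : σ.H) (l : τ.H) :
    inclLeft ρ σ τ (h ⊗ₜ (k ⊗ₜ l)) = ρ.incl σ (h ⊗ₜ k) ⊗ₜ l := rfl

theorem inclRight_zero : inclRight ρ σ τ 0 = 0 := (inclRight ρ σ τ).toLinearMap.map_zero

theorem inclLeft_zero : inclLeft ρ σ τ 0 = 0 := (inclLeft ρ σ τ).toLinearMap.map_zero

theorem denseRange_inclRight : DenseRange (inclRight ρ σ τ) := by
  intro v
  let M : Submodule ℂ (ρ.H ⊗[ℂ] (σ.tensor τ).H) :=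
    (LinearMap.range (inclRight ρ σ τ).toLinearMap).topologicalClosure
  change v ∈ M
  induction v using TensorProduct.induction_on with
  | zero => exact M.zero_mem
  | add v w hv hw => exact M.add_mem hv hw
  | tmul h k =>
    have hc : Continuous fun k : (σ.tensor τ).H => h ⊗ₜ[ℂ] k :=
      TensorProduct.continuous_tmul.comp (by fun_prop : Continuous fun k => (h, k))
    refine (σ.denseRange_incl τ).induction_on (p := fun k => h ⊗ₜ[ℂ] k ∈ M) k ?_ fun v => ?_
    · exact IsClosed.preimage hc (Submodule.isClosed_topologicalClosure _)
    · exact Submodule.le_topologicalClosure _ ⟨h ⊗ₜ v, rfl⟩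

/-- Two operators on `H ⊙ (K ⊗ L)` and on `(H ⊗ K) ⊙ L` that restrict to the same operator on
`H ⊙ K ⊙ L`. -/
def Agree (x : A ⊗[ℂ] MinTensor B C) (y : MinTensor A B ⊗[ℂ] C) : Prop :=
  ∀ v, ∃ w, ρ.tensorOp (σ.tensor τ) x (inclRight ρ σ τ v) = inclRight ρ σ τ w ∧
    (ρ.tensor σ).tensorOp τ y (inclLeft ρ σ τ v) = inclLeft ρ σ τ w

variable {ρ σ τ}

theorem Agree.add {x x' : A ⊗[ℂ] MinTensor B C} {y y' : MinTensor A B ⊗[ℂ] C}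
    (h : Agree ρ σ τ x y) (h' : Agree ρ σ τ x' y') : Agree ρ σ τ (x + x') (y + y') := fun v => by
  obtain ⟨w, hw₁, hw₂⟩ := h v
  obtain ⟨w', hw₁', hw₂'⟩ := h' v
  refine ⟨w + w', ?_, ?_⟩
  · rw [map_add, add_apply, hw₁, hw₁', map_add]
  · rw [map_add, add_apply, hw₂, hw₂', map_add]

theorem Agree.zero : Agree ρ σ τ (0 : A ⊗[ℂ] MinTensor B C) 0 := fun v =>
  ⟨0, by rw [map_zero, inclRight_zero]; rfl, by rw [map_zero, inclLeft_zero]; rfl⟩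

theorem Agree.sum {ι : Type*} (s : Finset ι) {x : ι → A ⊗[ℂ] MinTensor B C}
    {y : ι → MinTensor A B ⊗[ℂ] C} (h : ∀ i, Agree ρ σ τ (x i) (y i)) :
    Agree ρ σ τ (∑ i ∈ s, x i) (∑ i ∈ s, y i) := by
  classical
  induction s using Finset.induction_on with
  | empty => exact Agree.zero
  | insert i s hi ih =>
    rw [Finset.sum_insert hi, Finset.sum_insert hi]
    exact (h i).add ih

theorem Agree.smul {x : A ⊗[ℂ] MinTensor B C} {y : MinTensor A B ⊗[ℂ] C} (c : ℂ)
    (h : Agree ρ σ τ x y) : Agree ρ σ τ (c • x) (c • y) := fun v => by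
  obtain ⟨w, hw₁, hw₂⟩ := h v
  refine ⟨c • w, ?_, ?_⟩
  · rw [map_smul, smul_apply, hw₁, map_smul]
  · rw [map_smul, smul_apply, hw₂, map_smul]

theorem Agree.one : Agree ρ σ τ (1 : A ⊗[ℂ] MinTensor B C) 1 := fun v =>
  ⟨v, by rw [map_one]; rfl, by rw [map_one]; rfl⟩

theorem Agree.mul {x x' : A ⊗[ℂ] MinTensor B C} {y y' : MinTensor A B ⊗[ℂ] C}
    (h : Agree ρ σ τ x y) (h' : Agree ρ σ τ x' y') : Agree ρ σ τ (x * x') (y * y') := fun v => by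
  obtain ⟨w, hw₁, hw₂⟩ := h' v
  obtain ⟨w', hw₁', hw₂'⟩ := h w
  refine ⟨w', ?_, ?_⟩
  · rw [map_mul, mul_apply_eq_comp, hw₁, hw₁']
  · rw [map_mul, mul_apply_eq_comp, hw₂, hw₂']

theorem Agree.tmul (a : A) (b : B) (c : C) :
    Agree ρ σ τ (a ⊗ₜ QPerm.tmul b c) (QPerm.tmul a b ⊗ₜ c) := fun v => by
  refine ⟨TensorProduct.map (ρ.π a : ρ.H →ₗ[ℂ] ρ.H)
    (TensorProduct.map (σ.π b : σ.H →ₗ[ℂ] σ.H) (τ.π c : τ.H →ₗ[ℂ] τ.H)) v, ?_, ?_⟩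
  · induction v using TensorProduct.induction_on with
    | zero => simp only [map_zero, inclRight_zero]
    | add v w hv hw => simp only [map_add, hv, hw]
    | tmul h v =>
      rw [tensorOp_tmul, inclRight_tmul, TensorProduct.mapL_tmul, tensor_tmul_incl]
      rfl
  · induction v using TensorProduct.induction_on with
    | zero => simp only [map_zero, inclLeft_zero]
    | add v w hv hw => simp only [map_add, hv, hw]
    | tmul h v =>
      induction v using TensorProduct.induction_on with
      | zero => simp only [TensorProduct.tmul_zero, map_zero, inclLeft_zero]
      | add v w hv hw => simp only [TensorProduct.tmul_add, map_add, hv, hw]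
      | tmul k l =>
        rw [tensorOp_tmul, inclLeft_tmul, TensorProduct.mapL_tmul, tensor_tmul_incl]
        rfl

/-- Both inclusions of `H ⊙ K ⊙ L` are isometric, and the range of `inclRight` is dense, so the
left-hand norm can be tested on vectors that also live on the right-hand side. -/
theorem Agree.tensorNorm_le {x : A ⊗[ℂ] MinTensor B C} {y : MinTensor A B ⊗[ℂ] C}
    (h : Agree ρ σ τ x y) : ρ.tensorNorm (σ.tensor τ) x ≤ (ρ.tensor σ).tensorNorm τ y := by
  refine Rep.tensorNorm_le _ _ _ (tensorNorm_nonneg _ _ _) fun v => ?_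
  refine (denseRange_inclRight ρ σ τ).induction_on (p := fun v =>
    ‖ρ.tensorOp (σ.tensor τ) x v‖ ≤ (ρ.tensor σ).tensorNorm τ y * ‖v‖) v ?_ fun v => ?_
  · exact isClosed_le (by fun_prop) (by fun_prop)
  · obtain ⟨w, hw₁, hw₂⟩ := h v
    have h1 := (ρ.tensor σ).norm_tensorOp_apply_le τ y (inclLeft ρ σ τ v)
    rw [hw₂, LinearIsometry.norm_map, LinearIsometry.norm_map] at h1
    rw [hw₁, LinearIsometry.norm_map, LinearIsometry.norm_map]
    exact h1

end assoc

end Rep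

namespace MatPair

variable {N : ℕ}

theorem evTensor_gen (P Q : MatPair N) (ij : Fin N × Fin N) :
    P.evTensor Q (FreeStar.gen ij) = ∑ k, P.M ij.1 k ⊗ₜ Q.M k ij.2 :=
  FreeStar.eval_gen _ ij

theorem evTensor_star_gen (P Q : MatPair N) (ij : Fin N × Fin N) :
    P.evTensor Q (star (FreeStar.gen ij)) = ∑ k, star (P.M ij.1 k) ⊗ₜ star (Q.M k ij.2) := by
  rw [map_star, evTensor_gen, star_sum]
  rfl

theorem oprod_M (P Q : MatPair N) (i j : Fin N) :
    (P.oprod Q).M i j = ∑ k, tmul (P.M i k) (Q.M k j) := rfl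

theorem star_oprod_M (P Q : MatPair N) (i j : Fin N) :
    star ((P.oprod Q).M i j) = ∑ k, tmul (star (P.M i k)) (star (Q.M k j)) := by
  change star (∑ k, tmul (P.M i k) (Q.M k j)) = _
  exact (star_sum _ _).trans (Finset.sum_congr rfl fun _ _ => star_tmul _ _)

/-- `Agree` is closed under the algebra operations. On generators and their adjoints both sides are
sums of elementary triple tensors with different bracketings. -/
theorem agree_ev (P Q R : MatPair N) (ρ : Rep P.D) (σ : Rep Q.D) (τ : Rep R.D)
    (f : FreeStar (Fin N × Fin N)) :
    Rep.Agree ρ σ τ (P.evTensor (Q.oprod R) f) ((P.oprod Q).evTensor R f) := by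
  induction f using FreeStar.induction with
  | hgen ij =>
    have h1 : P.evTensor (Q.oprod R) (FreeStar.gen ij) =
        ∑ k, ∑ l, P.M ij.1 k ⊗ₜ[ℂ] tmul (Q.M k l) (R.M l ij.2) := by
      rw [evTensor_gen]
      simp only [oprod_M]
      exact Finset.sum_congr rfl fun k _ => TensorProduct.tmul_sum ..
    have h2 : (P.oprod Q).evTensor R (FreeStar.gen ij) =
        ∑ k, ∑ l, tmul (P.M ij.1 k) (Q.M k l) ⊗ₜ[ℂ] R.M l ij.2 := by
      rw [evTensor_gen, Finset.sum_comm]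
      simp only [oprod_M]
      exact Finset.sum_congr rfl fun k _ => TensorProduct.sum_tmul ..
    rw [h1, h2]
    exact .sum _ fun k => .sum _ fun l => .tmul _ _ _
  | hstar ij =>
    have h1 : P.evTensor (Q.oprod R) (star (FreeStar.gen ij)) =
        ∑ k, ∑ l, star (P.M ij.1 k) ⊗ₜ[ℂ] tmul (star (Q.M k l)) (star (R.M l ij.2)) := by
      rw [evTensor_star_gen]
      simp only [star_oprod_M]
      exact Finset.sum_congr rfl fun k _ => TensorProduct.tmul_sum ..
    have h2 : (P.oprod Q).evTensor R (star (FreeStar.gen ij)) =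
        ∑ k, ∑ l, tmul (star (P.M ij.1 k)) (star (Q.M k l)) ⊗ₜ[ℂ] star (R.M l ij.2) := by
      rw [evTensor_star_gen, Finset.sum_comm]
      simp only [star_oprod_M]
      exact Finset.sum_congr rfl fun k _ => TensorProduct.sum_tmul ..
    rw [h1, h2]
    exact .sum _ fun k => .sum _ fun l => .tmul _ _ _
  | hone => rw [map_one, map_one]; exact .one
  | hmul a b ha hb => rw [map_mul, map_mul]; exact ha.mul hb
  | hadd a b ha hb => rw [map_add, map_add]; exact ha.add hb
  | hsmul c a ha => rw [map_smul, map_smul]; exact ha.smul c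

/-- This half of associativity suffices for moving factors to the left in `pow_oprod_pow_le`.
Testing the inner tensor product on product representations reduces it to `agree_ev`. -/
theorem oprod_assoc_le (P Q R : MatPair N) :
    (P.oprod (Q.oprod R)).Le ((P.oprod Q).oprod R) := fun f => by
  rw [norm_ev_oprod, norm_ev_oprod]
  refine Rep.minNorm_le Rep.separating_univ Rep.separating_tensor _
    ((minNorm _ _).nonneg _) ?_
  rintro ρ - _ ⟨σ, τ, rfl⟩
  exact (agree_ev P Q R ρ σ τ f).tensorNorm_le.trans (Rep.tensorNorm_le_minNorm _ _ _)

end MatPair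

/-! ### Universal C*-algebras, noncommuting projections and slice embeddings. -/

section Universal

variable {X : Type} (rel : ∀ (D : Type) [CStarAlgebra D], (X → D) → Prop)
  (hrel : ∀ x, ∃ C : ℝ, ∀ r : Realisation X rel, ‖r.f x‖ ≤ C)

/-- The universal property of `C*(X | rel)`. -/
theorem exists_univ_lift (r : Realisation X rel) :
    ∃ φ : UnivCStar rel hrel →⋆ₐ[ℂ] r.D, ∀ x, φ (univGen rel hrel x) = r.f x := by
  obtain ⟨φ, hφ⟩ := (univSeminorm rel hrel).exists_lift (FreeStar.eval r.f) fun x =>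
    le_ciSup (FreeStar.bddAbove_eval (fun r : Realisation X rel => r.f) hrel x) r
  exact ⟨φ, fun x => (hφ _).trans (FreeStar.eval_gen _ _)⟩

end Universal

/-- The universal property of the C*-algebra generated by two projections. -/
theorem exists_twoProj_lift {D : Type} [CStarAlgebra D] {p q : D} (hp : IsStarProjection p)
    (hq : IsStarProjection q) : ∃ φ : TwoProj →⋆ₐ[ℂ] D, φ projP = p ∧ φ projQ = q := by
  obtain ⟨φ, hφ⟩ := exists_univ_lift
    (fun (D : Type) [CStarAlgebra D] (f : Fin 2 → D) => ∀ x, IsStarProjection (f x))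
    (fun x => ⟨1, fun r => (r.holds x).norm_le⟩) ⟨D, ![p, q], fun x => by fin_cases x <;> assumption⟩
  exact ⟨φ, hφ 0, hφ 1⟩

open scoped ComplexOrder in
/-- The two generating projections of `A` do not commute. -/
theorem projP_mul_projQ_ne : projP * projQ ≠ projQ * projP := by
  intro h
  -- Orthogonal projections onto two lines at an angle of 45 degrees; the products differ at
  -- position `(0, 1)`, where they are `1 / 2` and `0`.
  let P : Matrix (Fin 2) (Fin 2) ℂ := !![1, 0; 0, 0]
  let Q : Matrix (Fin 2) (Fin 2) ℂ := !![1 / 2, 1 / 2; 1 / 2, 1 / 2]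
  have hP : P * P = P := by
    ext i j
    fin_cases i <;> fin_cases j <;> simp [P]
  have hP' : P.conjTranspose = P := by
    ext i j
    fin_cases i <;> fin_cases j <;> simp [P]
  have hQ : Q * Q = Q := by
    ext i j
    fin_cases i <;> fin_cases j <;> norm_num [Q, Matrix.mul_apply, Fin.sum_univ_two]
  have hQ' : Q.conjTranspose = Q := by
    ext i j
    fin_cases i <;> fin_cases j <;> simp [Q]
  have hp : IsStarProjection (CStarMatrix.ofMatrix P) := ⟨hP, hP'⟩
  have hq : IsStarProjection (CStarMatrix.ofMatrix Q) := ⟨hQ, hQ'⟩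
  obtain ⟨φ, hφp, hφq⟩ := exists_twoProj_lift hp hq
  have h1 : CStarMatrix.ofMatrix P * CStarMatrix.ofMatrix Q =
      CStarMatrix.ofMatrix Q * CStarMatrix.ofMatrix P := by
    rw [← hφp, ← hφq, ← map_mul, ← map_mul, h]
  have h2 : P * Q = Q * P := h1
  have h3 := congrFun (congrFun h2 0) 1
  simp [P, Q] at h3

section slices

variable {A B : Type} [CStarAlgebra A] [CStarAlgebra B]

/-- The inclusion `b ↦ 1 ⊗ b`. -/
def tmulRight (A : Type) {B : Type} [CStarAlgebra A] [CStarAlgebra B] : B →⋆ₐ[ℂ] MinTensor A B where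
  __ := (minNorm A B).toCompl.toAlgHom.comp Algebra.TensorProduct.includeRight
  map_star' b := by
    change tmul 1 (star b) = star (tmul 1 b)
    rw [star_tmul, star_one]

/-- The inclusion `a ↦ a ⊗ 1`. -/
def tmulLeft {A : Type} (B : Type) [CStarAlgebra A] [CStarAlgebra B] : A →⋆ₐ[ℂ] MinTensor A B where
  __ := (minNorm A B).toCompl.toAlgHom.comp Algebra.TensorProduct.includeLeft
  map_star' a := by
    change tmul (star a) 1 = star (tmul a 1)
    rw [star_tmul, star_one]

/-- If `a ⊗ b` vanished, then `ρ(a)v ⊗ σ(b)w` would vanish for all representations and vectors,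
while its norm is the product of the norms of its legs. This makes the slice embeddings injective.
-/
theorem tmul_ne_zero {a : A} {b : B} (ha : a ≠ 0) (hb : b ≠ 0) : tmul a b ≠ 0 := by
  intro h
  have h0 : (minNorm A B).toFun (a ⊗ₜ b) = 0 := by
    rw [← CStarSeminorm.norm_coe]
    exact norm_eq_zero.2 h
  refine ha (Rep.separating_univ a fun ρ _ => ContinuousLinearMap.ext fun v => ?_)
  by_contra hv
  refine hb (Rep.separating_univ b fun σ _ => ContinuousLinearMap.ext fun w => ?_)
  have h1 := ρ.norm_tensorOp_apply_le σ (a ⊗ₜ b) (v ⊗ₜ w)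
  have h2 := (ρ.tensorNorm_le_minNorm σ (a ⊗ₜ b)).trans_eq h0
  rw [Rep.tensorOp_tmul, TensorProduct.mapL_tmul, TensorProduct.norm_tmul] at h1
  have h3 := h1.trans (mul_nonpos_of_nonpos_of_nonneg h2 (norm_nonneg _))
  have h4 : 0 < ‖ρ.π a v‖ := norm_pos_iff.2 hv
  exact norm_le_zero_iff.1 (nonpos_of_mul_nonpos_right h3 h4)

theorem tmulRight_injective [Nontrivial A] :
    Function.Injective (tmulRight A : B →⋆ₐ[ℂ] MinTensor A B) :=
  (injective_iff_map_eq_zero _).2 fun b hb => by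
    by_contra h
    exact tmul_ne_zero (one_ne_zero (α := A)) h hb

theorem tmulLeft_injective [Nontrivial B] :
    Function.Injective (tmulLeft B : A →⋆ₐ[ℂ] MinTensor A B) :=
  (injective_iff_map_eq_zero _).2 fun a ha => by
    by_contra h
    exact tmul_ne_zero h (one_ne_zero (α := B)) ha

end slices

/-! ### Permutation matrices, products, powers and relations that survive domination. -/

namespace MatPair

variable {N : ℕ}

/-- The pair of a permutation matrix over `ℂ`. -/
def permPair (σ : Equiv.Perm (Fin N)) : MatPair N :=
  ⟨ℂ, Matrix.of fun i j => if i = σ j then 1 else 0⟩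

theorem permPair_M (σ : Equiv.Perm (Fin N)) (i j : Fin N) :
    (permPair σ).M i j = if i = σ j then (1 : ℂ) else 0 := rfl

/-- A pair is dominated by its product with the identity matrix on the left. -/
theorem le_one_oprod (P : MatPair N) : P.Le ((permPair 1).oprod P) := by
  refine Arrow.le_of_injective ⟨tmulRight ℂ, fun i j => ?_⟩ tmulRight_injective
  have h : (permPair (1 : Equiv.Perm (Fin N))).M i i = (1 : ℂ) := if_pos rfl
  rw [oprod_M, Finset.sum_eq_single i]
  · exact congrArg (tmul · (P.M i j)) h.symm
  · intro k _ hk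
    rw [permPair_M, if_neg (by simpa using hk.symm)]
    exact zero_tmul _
  · simp

/-- A pair is dominated by its product with the identity matrix on the right. -/
theorem le_oprod_one (P : MatPair N) : P.Le (P.oprod (permPair 1)) := by
  refine Arrow.le_of_injective ⟨tmulLeft ℂ, fun i j => ?_⟩ tmulLeft_injective
  have h : (permPair (1 : Equiv.Perm (Fin N))).M j j = (1 : ℂ) := if_pos rfl
  rw [oprod_M, Finset.sum_eq_single j]
  · exact congrArg (tmul (P.M i j)) h.symm
  · intro k _ hk
    rw [permPair_M, if_neg (by simpa using hk)]
    exact congrArg (minNorm P.D ℂ).toCompl (TensorProduct.tmul_zero ..)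
  · simp

/-- Only `k = τ j` contributes to the entry of the product, which becomes `δ_{i,σ(τ j)} ⊗ 1` in `ℂ ⊗
ℂ`. -/
theorem permPair_mul_le (σ τ : Equiv.Perm (Fin N)) :
    (permPair (σ * τ)).Le ((permPair σ).oprod (permPair τ)) := by
  refine Arrow.le_of_injective ⟨tmulRight ℂ, fun i j => ?_⟩ tmulRight_injective
  rw [oprod_M, Finset.sum_eq_single (τ j), permPair_M, permPair_M, permPair_M, if_pos rfl,
    Equiv.Perm.mul_apply]
  · split_ifs
    · rfl
    · exact (map_zero _).trans (zero_tmul _).symm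
  · intro k _ hk
    rw [permPair_M τ, if_neg hk]
    exact congrArg (minNorm ℂ ℂ).toCompl (TensorProduct.tmul_zero ..)
  · simp

theorem permPair_foldl_le (l : List (Equiv.Perm (Fin N))) (σ : Equiv.Perm (Fin N)) {P : MatPair N}
    (hP : (permPair σ).Le P) :
    (permPair (σ * l.prod)).Le ((l.map permPair).foldl oprod P) := by
  induction l generalizing σ P with
  | nil => simpa using hP
  | cons τ l ih =>
    rw [List.prod_cons, ← mul_assoc]
    exact ih (σ * τ) ((permPair_mul_le σ τ).trans (hP.oprod (Le.refl _)))

theorem permPair_prod_le (l : List (Equiv.Perm (Fin N))) :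
    (permPair l.prod).Le (listProd (l.map permPair)) := by
  cases l with
  | nil =>
    refine Arrow.le_of_injective ⟨StarAlgHom.id ℂ ℂ, fun i j => ?_⟩ Function.injective_id
    exact (permPair_M 1 i j).trans (Matrix.one_apply ..).symm
  | cons σ l =>
    rw [List.prod_cons]
    exact permPair_foldl_le l σ (Le.refl _)

theorem permPair_prod_le_pow {P : MatPair N} (l : List (Equiv.Perm (Fin N)))
    (h : ∀ σ ∈ l, (permPair σ).Le P) : (permPair l.prod).Le (P.pow l.length) := by
  refine (permPair_prod_le l).trans (le_listProd ?_)
  induction l with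
  | nil => exact .nil
  | cons σ l ih =>
    exact .cons (h σ List.mem_cons_self) (ih fun τ hτ => h τ (List.mem_cons_of_mem _ hτ))

theorem le_foldl_of_one_le {l : List (MatPair N)} (h : ∀ X ∈ l, (permPair 1).Le X)
    {P Q : MatPair N} (hP : Q.Le P) : Q.Le (l.foldl oprod P) := by
  induction l generalizing P with
  | nil => exact hP
  | cons X l ih =>
    exact ih (fun Y hY => h Y (List.mem_cons_of_mem _ hY))
      ((le_oprod_one Q).trans (hP.oprod (h X List.mem_cons_self)))

/-- If all factors of a product dominate the identity matrix, then the product dominates each of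
its factors. -/
theorem le_listProd_of_mem {l : List (MatPair N)} (h : ∀ X ∈ l, (permPair 1).Le X)
    {P : MatPair N} (hP : P ∈ l) : P.Le (listProd l) := by
  obtain ⟨l₁, l₂, rfl⟩ := List.append_of_mem hP
  have h₂ : ∀ X ∈ l₂, (permPair 1).Le X := fun X hX => h X (by simp [hX])
  cases l₁ with
  | nil => exact le_foldl_of_one_le h₂ (Le.refl P)
  | cons X l₁ =>
    change P.Le ((l₁ ++ P :: l₂).foldl oprod X)
    rw [List.foldl_append, List.foldl_cons]
    -- The factors in front of `P` together dominate the identity, so the partial product ending in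
    -- `P` dominates `1 ⊥ P`, and hence `P`.
    refine le_foldl_of_one_le h₂ ((le_one_oprod P).trans (Le.oprod ?_ (Le.refl P)))
    exact le_foldl_of_one_le (fun Y hY => h Y (by simp [hY])) (h X (by simp))

/-- Powers are left-nested, so a new factor enters on the right. The exponent starts at two because
`pow 1` is `P` itself and not a product with the empty power. -/
theorem pow_add_two (P : MatPair N) (n : ℕ) : P.pow (n + 2) = (P.pow (n + 1)).oprod P := by
  change (List.replicate (n + 1) P).foldl oprod P = ((List.replicate n P).foldl oprod P).oprod P
  rw [List.replicate_succ', List.foldl_append]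
  rfl

/-- Induction on `m`: the last factor of the right-hand power is split off by `oprod_assoc_le`,
which rebrackets everything into left-nested form. -/
theorem pow_oprod_pow_le (P : MatPair N) (n m : ℕ) :
    ((P.pow (n + 1)).oprod (P.pow (m + 1))).Le (P.pow (n + m + 2)) := by
  induction m with
  | zero => rw [Nat.add_zero, pow_add_two]; exact Le.refl _
  | succ m ih =>
    rw [pow_add_two P m, ← add_assoc, pow_add_two P (n + m + 1)]
    exact (oprod_assoc_le _ _ _).trans (ih.oprod (Le.refl P))

theorem ev_gen (P : MatPair N) (i j : Fin N) : P.ev (FreeStar.gen (i, j)) = P.M i j :=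
  FreeStar.eval_gen _ _

/-- Domination with the bound `C = 0`: *-polynomial identities that hold in all members of the
family are inherited. -/
theorem Dominated.ev_eq {ι : Sort*} {P : MatPair N} {Q : ι → MatPair N} (h : P.Dominated Q)
    {f g : FreeStar (Fin N × Fin N)} (hfg : ∀ i, (Q i).ev f = (Q i).ev g) : P.ev f = P.ev g := by
  rw [← sub_eq_zero, ← map_sub, ← norm_le_zero_iff]
  refine h _ 0 le_rfl fun i => ?_
  rw [map_sub, hfg i, sub_self, norm_zero]

theorem Dominated.isMagic {ι : Sort*} {P : MatPair N} {Q : ι → MatPair N} (h : P.Dominated Q)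
    (hQ : ∀ i, IsMagic (Q i).M) : IsMagic P.M where
  proj i j := by
    constructor
    · change P.M i j * P.M i j = P.M i j
      rw [← ev_gen, ← map_mul]
      refine h.ev_eq fun n => ?_
      rw [map_mul, ev_gen]
      exact ((hQ n).proj i j).isIdempotentElem
    · change star (P.M i j) = P.M i j
      rw [← ev_gen, ← map_star]
      refine h.ev_eq fun n => ?_
      rw [map_star, ev_gen]
      exact ((hQ n).proj i j).isSelfAdjoint
  row i := by
    simp only [← ev_gen, ← map_sum]
    rw [← map_one P.ev]
    refine h.ev_eq fun n => ?_
    simp only [map_sum, ev_gen, map_one]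
    exact (hQ n).row i
  col j := by
    simp only [← ev_gen, ← map_sum]
    rw [← map_one P.ev]
    refine h.ev_eq fun n => ?_
    simp only [map_sum, ev_gen, map_one]
    exact (hQ n).col j

theorem ev_mem_entryAlg (P : MatPair N) (f : FreeStar (Fin N × Fin N)) : P.ev f ∈ P.entryAlg := by
  induction f using FreeStar.induction with
  | hgen ij => rw [ev_gen]; exact P.mem_entryAlg _ _
  | hstar ij => rw [map_star, ev_gen]; exact star_mem (P.mem_entryAlg _ _)
  | hone => rw [map_one]; exact one_mem _
  | hmul a b ha hb => rw [map_mul]; exact mul_mem ha hb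
  | hadd a b ha hb => rw [map_add]; exact add_mem ha hb
  | hsmul c a ha => rw [map_smul]; exact SMulMemClass.smul_mem c ha

theorem entryAlg_supPair {ι : Sort*} (P : ι → MatPair N)
    (hP : ∀ i j, ∃ C : ℝ, ∀ n, ‖(P n).M i j‖ ≤ C) : (supPair P hP).entryAlg = ⊤ := by
  refine eq_top_iff.2 fun a _ => ?_
  have h : closure (Set.range (supPair P hP).ev) ⊆ (supPair P hP).entryAlg :=
    closure_minimal (by rintro _ ⟨f, rfl⟩; exact ev_mem_entryAlg _ f)
      (StarSubalgebra.isClosed_topologicalClosure _)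
  exact h (dense_supPair P hP a)

end MatPair

/-! ### Unitarity of magic unitaries and specialisations of the matrices `R`. -/

namespace IsMagic

variable {N : ℕ} {D : Type*} [CStarAlgebra D] {u : Matrix (Fin N) (Fin N) D}

theorem transpose (hu : IsMagic u) : IsMagic u.transpose :=
  ⟨fun i j => hu.proj j i, hu.col, hu.row⟩

theorem map_star_eq (hu : IsMagic u) : u.map star = u := by
  ext i j
  exact (hu.proj i j).isSelfAdjoint

theorem mul_transpose (hu : IsMagic u) : u * u.transpose = 1 := by
  ext i j
  rw [Matrix.mul_apply, Matrix.one_apply]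
  split_ifs with h
  · subst h
    rw [← hu.row i]
    exact Finset.sum_congr rfl fun k _ => (hu.proj i k).isIdempotentElem
  -- Distinct entries of one column are orthogonal: this is the row statement for the transpose.
  · exact Finset.sum_eq_zero fun k _ => hu.transpose.mul_eq_zero k h

theorem mem_unitary (hu : IsMagic u) : u ∈ unitary (Matrix (Fin N) (Fin N) D) := by
  have h : star u = u.transpose := by
    ext i j
    exact (hu.proj j i).isSelfAdjoint
  rw [Unitary.mem_iff, h]
  exact ⟨hu.transpose.mul_transpose, hu.mul_transpose⟩

end IsMagic

theorem map_matR {N : ℕ} {D D' : Type*} [Ring D] [Ring D'] (φ : D →+* D') (p q : D)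
    (a b c d i j : Fin N) : φ (matR p q a b c d i j) = matR (φ p) (φ q) a b c d i j := by
  simp only [matR, Matrix.of_apply]
  split_ifs <;> simp

namespace MatPair

variable {N : ℕ}

/-- Substituting concrete projections for `p` and `q` is an arrow out of `pairR`, by the universal
property of `TwoProj`. -/
theorem pairR_ge {D : Type} [CStarAlgebra D] {p q : D} (hp : IsStarProjection p)
    (hq : IsStarProjection q) {M : Matrix (Fin N) (Fin N) D} {a b c d : Fin N}
    (h : ∀ i j, matR p q a b c d i j = M i j) : Le ⟨D, M⟩ (pairR a b c d) := by
  obtain ⟨φ, hφp, hφq⟩ := exists_twoProj_lift hp hq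
  refine Arrow.le ⟨φ, fun i j => ?_⟩
  refine (map_matR (φ : TwoProj →+* D) projP projQ a b c d i j).trans ?_
  change matR (φ projP) (φ projQ) a b c d i j = M i j
  rw [hφp, hφq, h]

theorem one_le_pairR (a b c d : Fin N) : (permPair 1).Le (pairR a b c d) := by
  refine pairR_ge (IsStarProjection.one ℂ) (IsStarProjection.one ℂ) fun i j => ?_
  change matR (1 : ℂ) 1 a b c d i j = if i = j then 1 else 0
  simp [matR]

theorem swap_le_pairR {a b c d : Fin N} (hab : a ≠ b) :
    (permPair (Equiv.swap a b)).Le (pairR a b c d) := by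
  -- At `p = 0` the block of `a` and `b` becomes a swap, and `q = 1` makes the remaining part the
  -- identity.
  refine pairR_ge (IsStarProjection.zero ℂ) (IsStarProjection.one ℂ) fun i j => ?_
  simp only [matR, Matrix.of_apply, Equiv.swap_apply_def]
  grind

end MatPair

/-! ### The pairs `Bₙ` and their limit. -/

namespace StartData

open MatPair

variable {N : ℕ} (s : StartData N)

theorem one_le_R {P : MatPair N} (hP : P ∈ s.pairs.map s.R) : (permPair 1).Le P := by
  obtain ⟨ab, -, rfl⟩ := List.mem_map.1 hP
  exact one_le_pairR _ _ _ _

theorem R_le {a b : Fin N} (h : a < b) :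
    (s.R (a, b)).Le (listProd (s.pairs.map s.R)) :=
  le_listProd_of_mem (fun _ => s.one_le_R)
    (List.mem_map_of_mem ((s.mem_pairs (a, b)).2 h))

theorem one_le_listProd_R (hN : 2 ≤ N) : (permPair 1).Le (listProd (s.pairs.map s.R)) :=
  (one_le_pairR _ _ _ _).trans
    (s.R_le (a := ⟨0, by omega⟩) (b := ⟨1, by omega⟩) (by simp [Fin.lt_def]))

theorem swap_le_listProd_R {σ : Equiv.Perm (Fin N)} (hσ : σ.IsSwap) :
    (permPair σ).Le (listProd (s.pairs.map s.R)) := by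
  obtain ⟨a, b, hab, rfl⟩ := hσ
  rcases lt_or_gt_of_ne hab with h | h
  · exact (swap_le_pairR hab).trans (s.R_le h)
  · rw [Equiv.swap_comm]
    exact (swap_le_pairR hab.symm).trans (s.R_le h)

theorem permPair_le_B₁ (hN : 2 ≤ N) (σ : Equiv.Perm (Fin N)) : (permPair σ).Le s.B₁ := by
  obtain ⟨l, hl, hs, rfl⟩ := s.prod_of_swaps σ
  refine Le.trans ?_ (le_cut _)
  -- `M₁` is a power with exactly `L` factors, whereas `σ` may need fewer transpositions; identities
  -- fill the remaining places.
  have h := permPair_prod_le_pow (P := listProd (s.pairs.map s.R))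
    (l ++ List.replicate (s.L - l.length) 1) fun τ hτ => by
      rcases List.mem_append.1 hτ with h | h
      · exact s.swap_le_listProd_R (hs τ h)
      · rw [List.eq_of_mem_replicate h]
        exact s.one_le_listProd_R hN
  rwa [List.prod_append, List.prod_replicate, one_pow, mul_one, List.length_append,
    List.length_replicate, Nat.add_sub_cancel' hl] at h

/-- A transposition is not an empty product. Positivity of `L` ensures that a factor is present in
the power, so that `M₁` dominates the matrices `R`. -/
theorem L_pos (hN : 2 ≤ N) : 0 < s.L := by
  rw [Nat.pos_iff_ne_zero]
  intro h0
  obtain ⟨l, hl, -, h⟩ := s.prod_of_swaps (Equiv.swap ⟨0, by omega⟩ ⟨1, by omega⟩)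
  rw [h0, Nat.le_zero, List.length_eq_zero_iff] at hl
  rw [hl, List.prod_nil, eq_comm, Equiv.swap_eq_one_iff] at h
  simp at h

theorem R_le_B₁ {a b : Fin N} (h : a < b) : (s.R (a, b)).Le s.B₁ := by
  have hN : 2 ≤ N := by have := a.2; have := b.2; rw [Fin.lt_def] at h; omega
  refine (s.R_le h).trans (Le.trans ?_ (le_cut _))
  refine le_listProd_of_mem (fun X hX => ?_)
    (List.mem_replicate.2 ⟨(s.L_pos hN).ne', rfl⟩)
  rw [List.eq_of_mem_replicate hX]
  exact s.one_le_listProd_R hN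

/-- The entries of the matrices `Mₙ` are uniformly bounded. -/
theorem bounded_B (i j : Fin N) : ∃ C : ℝ, ∀ n, ‖(s.B (n + 1)).M i j‖ ≤ C :=
  ⟨1, fun n => (s.B_magic (n + 1)).norm_le_one i j⟩

theorem pow_le_Binf (n : ℕ) : (s.B₁.pow (n + 1)).Le s.Binf :=
  (le_cut _).trans (le_supPair (fun n => s.B (n + 1)) s.bounded_B n)

/-- The family is indexed by `n + 1`, so its member at `0` comes from the first power, which unfolds
to `B₁`. -/
theorem B₁_le_Binf : s.B₁.Le s.Binf := s.pow_le_Binf 0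

theorem Binf_dominated : s.Binf.Dominated fun n => s.B (n + 1) :=
  supPair_dominated _ s.bounded_B

theorem Binf_magic : IsMagic s.Binf.M := s.Binf_dominated.isMagic fun n => s.B_magic (n + 1)

/-- Each leg of the product is dominated by the family of the `Bₙ`, and the products of members are
absorbed by higher powers of `M₁`: the sum of the exponents `n + 1` and `m + 1` is again an exponent
in the family. -/
theorem Binf_oprod_le : (s.Binf.oprod s.Binf).Le s.Binf := fun f =>
  s.Binf_dominated.oprod s.Binf_dominated s.bounded_B s.bounded_B f _ (norm_nonneg _)
    fun nm => (((cut_le _).oprod (cut_le _)).trans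
      ((pow_oprod_pow_le s.B₁ nm.1 nm.2).trans (s.pow_le_Binf (nm.1 + nm.2 + 1)))) f

theorem Binf_isCMQG : s.Binf.IsCMQG where
  generated := entryAlg_supPair _ s.bounded_B
  unitary := s.Binf_magic.mem_unitary
  invertible := by
    rw [s.Binf_magic.map_star_eq]
    exact ⟨⟨_, _, s.Binf_magic.mul_transpose, s.Binf_magic.transpose.mul_transpose⟩, rfl⟩
  comul := by
    -- The entries of `Binf ⊥ Binf` are the prescribed values of the comultiplication, so an arrow
    -- to it is what is required.
    obtain ⟨Δ⟩ := exists_arrow_of_le _ s.bounded_B s.Binf_oprod_le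
    exact ⟨Δ.hom, Δ.map_entry⟩

/-- The norm of `C(S_N)` is the maximum over the points `σ`, and evaluation at `σ` turns the
generating matrix into the permutation matrix of `σ`. -/
theorem SN_le_Binf (hN : 2 ≤ N) : (SN N).Le s.Binf := fun f => by
  refine (pi_norm_le_iff_of_nonneg (norm_nonneg _)).2 fun σ => ?_
  refine le_of_eq_of_le ?_ (((s.permPair_le_B₁ hN σ).trans s.B₁_le_Binf) f)
  congr 1
  exact FreeStar.map_eval (D := Equiv.Perm (Fin N) → ℂ) (Pi.evalAlgHom ℂ (fun _ => ℂ) σ)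
    (fun _ => rfl) (fun _ => rfl) f

/-- The entries of `R_{(a,b),*}` at `(a,a)` and `(c,c)` are `p` and `q`. Since `Binf` dominates this
pair, commuting entries in the limit would force `p` and `q` to commute. -/
theorem not_commute_Binf (hN : 2 ≤ N) : ∃ x y : s.Binf.D, x * y ≠ y * x := by
  have hab : (⟨0, by omega⟩ : Fin N) < ⟨1, by omega⟩ := by simp [Fin.lt_def]
  generalize (⟨0, by omega⟩ : Fin N) = a, (⟨1, by omega⟩ : Fin N) = b at hab
  set c := s.c (a, b) with hc
  refine ⟨s.Binf.M a a, s.Binf.M c c, fun h => projP_mul_projQ_ne ?_⟩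
  have hd := s.distinct a b hab
  have hp : (s.R (a, b)).M a a = projP := by
    change matR projP projQ a b (s.c (a, b)) (s.d (a, b)) a a = projP
    simp [matR]
  have hq : (s.R (a, b)).M c c = projQ := by
    change matR projP projQ a b (s.c (a, b)) (s.d (a, b)) (s.c (a, b)) (s.c (a, b)) = projQ
    simp only [List.nodup_cons, List.mem_cons, List.not_mem_nil, or_false, not_or] at hd
    simp [matR, Ne.symm hd.1.2.1, Ne.symm hd.2.1.1]
  have h1 : s.Binf.ev (FreeStar.gen (a, a) * FreeStar.gen (c, c)) =
      s.Binf.ev (FreeStar.gen (c, c) * FreeStar.gen (a, a)) := by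
    rw [map_mul, map_mul, ev_gen, ev_gen, h]
  have h2 := ((s.R_le_B₁ hab).trans s.B₁_le_Binf).dominated.ev_eq fun _ => h1
  rw [map_mul, map_mul, ev_gen, ev_gen, hp, hq] at h2
  exact h2

end StartData

theorem exists_arrow_SNplus {N : ℕ} {P : MatPair N} (hP : IsMagic P.M) :
    Nonempty ((SNplus N).Arrow P) := by
  obtain ⟨φ, hφ⟩ := exists_univ_lift
    (fun (D : Type) [CStarAlgebra D] (u : Fin N × Fin N → D) =>
      IsMagic (Matrix.of fun i j => u (i, j)))
    (fun ij => ⟨1, fun r => r.holds.norm_le_one ij.1 ij.2⟩) ⟨P.D, fun ij => P.M ij.1 ij.2, hP⟩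
  exact ⟨φ, fun i j => hφ (i, j)⟩

end QPerm

end

theorem mainTheorem2 (N : ℕ) (hN : 4 ≤ N) (s : QPerm.StartData N) :
    s.Binf.IsCMQG ∧
      Nonempty ((QPerm.SNplus N).Arrow s.Binf) ∧
      ∃ φ : s.Binf.Arrow (QPerm.SN N), ¬ Function.Injective φ.hom := by
  refine ⟨s.Binf_isCMQG, QPerm.exists_arrow_SNplus s.Binf_magic, ?_⟩
  obtain ⟨φ⟩ := QPerm.MatPair.exists_arrow_of_le _ s.bounded_B (s.SN_le_Binf (by omega))
  refine ⟨φ, fun h => ?_⟩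
  obtain ⟨x, y, hxy⟩ := s.not_commute_Binf (by omega)
  -- An injective arrow would transfer commutativity from `C(S_N)` to `B_∞`.
  refine hxy (h ?_)
  rw [map_mul, map_mul]
  exact mul_comm (G := Equiv.Perm (Fin N) → ℂ) _ _
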